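/- Let $\mathbb D$ be the open unit disc of $\mathbb C$ and $dA$ the normalized Lebesgue measure on $\mathbb D$. For $1\le p<\infty$ and $\alpha>-1$, let $A^p_\alpha$ be the weighted Bergman space of all analytic functions $f$ on $\mathbb D$ with $\int_{\mathbb D}|f(z)|^p(1-|z|^2)^{\alpha}\,dA(z)<\infty$. For a positive Borel measure $\mu$ on $[0,1)$ and $\beta>0$ consider the Ces\`aro-type operator $$\mathcal C_{\mu,\beta}(f)(z)=\int_{[0,1)}\frac{f(tz)}{(1-tz)^\beta}\,d\mu(t),\qquad z\in\mathbb D .$$ We say that $\mathcal C_{\mu,\beta}$ maps $X$ into $Y$ if for every $f\in X$ this integral converges absolutely for every $z\in\mathbb D$ and $\mathcal C_{\mu,\beta}(f)\in Y$ (the convergence is automatic when $\mu$ is finite and $f$ is analytic on $\mathbb D$). For $s>0$, $\mu$ is called an $s$-Carleson measure if there is $C>0$ with $\mu([r,1))\le C(1-r)^s$ for all $0\le r<1$. Let $\mu$ be a positive Borel measure on $[0,1)$, let $1\le p\le q<\infty$ and $\beta>0$. (a) Let $\alpha_1,\alpha_2>-1$ satisfy $s:=\beta+\frac{\alpha_1+2}{p}-\frac{\alpha_2+2}{q}>0$.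 Then $\mathcal C_{\mu,\beta}$ maps $A^p_{\alpha_1}$ into $A^q_{\alpha_2}$ if and only if $\mu$ is an $s$-Carleson measure. (b) In particular, for every $\alpha>-1$, $\mathcal C_{\mu,\beta}$ maps $A^p_{\alpha}$ into $A^q_{\alpha}$ if and only if $\mu$ is an $s$-Carleson measure with $s=\beta+(2+\alpha)\left(\frac1p-\frac1q\right)$. -/

import Mathlib

open MeasureTheory Set

noncomputable section

namespace CesaroBergman

/-- The normalized Lebesgue (area) measure `dA` on the open unit disc of `ℂ`. -/
def diskArea : Measure ℂ :=
  ENNReal.ofReal (Real.pi⁻¹) • (volume.restrict (Metric.ball (0 : ℂ) 1))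

/-- The weighted Bergman space `A^p_α`: the functions that are analytic on the open unit disc and
satisfy `∫_𝔻 |f(z)|^p (1 - |z|²)^α dA(z) < ∞`. Values outside the disc play no role. -/
def bergmanSpace (p α : ℝ) : Set (ℂ → ℂ) :=
  {f | DifferentiableOn ℂ f (Metric.ball (0 : ℂ) 1) ∧
    ∫⁻ z, ENNReal.ofReal (‖f z‖ ^ p * (1 - ‖z‖ ^ 2) ^ α) ∂diskArea < ⊤}

/-- The integrand `f(tz) / (1 - tz)^β`, as a function of `t ∈ [0,1)` (principal branch of the
power; `1 - tz` has positive real part for `z` in the disc). -/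
def cesaroIntegrand (β : ℝ) (f : ℂ → ℂ) (z : ℂ) (t : Ico (0 : ℝ) 1) : ℂ :=
  f (((t : ℝ) : ℂ) * z) / (1 - ((t : ℝ) : ℂ) * z) ^ (β : ℂ)

/-- The Cesàro-type operator `C_{μ,β} f (z) = ∫_{[0,1)} f(tz) / (1 - tz)^β dμ(t)`. -/
def cesaroOp (μ : Measure (Ico (0 : ℝ) 1)) (β : ℝ) (f : ℂ → ℂ) (z : ℂ) : ℂ :=
  ∫ t, cesaroIntegrand β f z t ∂μ

/-- `C_{μ,β}` maps `X` into `Y`: for every `f ∈ X` the function `C_{μ,β} f` is well defined on the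
unit disc (its defining integral converges absolutely there) and belongs to `Y`.
Convergence is automatic for finite `μ` and `f` analytic on the disc. -/
def CesaroMapsInto (μ : Measure (Ico (0 : ℝ) 1)) (β : ℝ) (X Y : Set (ℂ → ℂ)) : Prop :=
  ∀ f ∈ X, (∀ z ∈ Metric.ball (0 : ℂ) 1, Integrable (cesaroIntegrand β f z) μ) ∧
    cesaroOp μ β f ∈ Y

/-- `μ` is an `s`-Carleson measure on `[0,1)`: `μ([r,1)) ≤ C (1 - r)^s` for some constant `C > 0`
and all `r ∈ [0,1)`. -/
def IsCarleson (μ : Measure (Ico (0 : ℝ) 1)) (s : ℝ) : Prop :=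
  ∃ C : ℝ, 0 < C ∧ ∀ r : ℝ, 0 ≤ r → r < 1 →
    μ {t | r ≤ (t : ℝ)} ≤ ENNReal.ofReal (C * (1 - r) ^ s)

end CesaroBergman

end

namespace CesaroBergman

/-! Write `M(r)` for the integral of `|f|^p` over the circle of radius `r`. Hardy's theorem says
that `M` increases (`circleMean_mono`). Integrating this over radii gives the sub-mean value
property, hence the growth bound `|f(z)| ≤ N (1 - |z|)^(-(α+2)/p)` on `A^p_α`
(`exists_growth_bound`). Both directions rest on these facts.

Sufficiency. Hölder in `t` with weight `(1 - t|z|)^a`, `a > s`, bounds `|C f(z)|^q` by an integral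
in `t`; the dual factor `∫ (1 - t|z|)^(-a) dμ` is at most a constant times `(1 - |z|)^(s-a)` by the
Carleson condition. Of `|f(tz)|^q`, only `|f(tz)|^p` is kept, the rest being absorbed by the growth
bound (`cesaroOp_rpow_le`). In polar coordinates it remains to bound a double integral of
`(1-r)^(η-1) (1-tr)^E M(tr)` in `r` and `μ(t)`. Since `M` increases, `M(tr)` is dominated by an
average of `M(u)` over radii `u` with `1 - u` comparable to `1 - tr`. For fixed `u`, both `1 - t`
and `1 - r` are then at most `4(1-u)`, so the two integrations contribute `(1-u)^s` and `(1-u)^η`.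
The exponents add up to `∫ (1-u)^α₁ M(u) du`, which is finite
(`lintegral_lintegral_circleMean_lt_top`).

Necessity. Instead of a closed graph argument, a single function defeats the operator. If `μ` is not
`s`-Carleson, there are `r_n` with `μ([r_n,1)) > 4^n (1-r_n)^s`. The sum of the normalized test
functions `(1-r_n)^b (1-r_n z)^(-N)` with weights `2^(-n-1)` lies in `A^p_α₁`. All its terms are
nonnegative on `[0,1)`, so its image at `r_n` is at least the contribution of the `n`-th term, of
order `2^n (1-r_n)^(-(α₂+2)/q)`. This contradicts the growth bound in `A^q_α₂`. -/

/-! ### Weighted Jensen inequality and integrals of powers -/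

/-- Jensen's inequality for powers, with respect to an arbitrary measure. -/
theorem lintegral_rpow_le_lintegral_rpow_mul {X : Type*} [MeasurableSpace X] (ν : Measure X)
    {q : ℝ} (hq : 1 ≤ q) {g : X → ENNReal} (hg : AEMeasurable g ν) :
    (∫⁻ x, g x ∂ν) ^ q ≤ (∫⁻ x, g x ^ q ∂ν) * ν univ ^ (q - 1) := by
  rcases hq.eq_or_lt with rfl | hq
  · simp
  have hq0 : 0 < q := by linarith
  have h := ENNReal.lintegral_mul_le_Lp_mul_Lq ν (Real.HolderConjugate.conjExponent hq) hg
    (aemeasurable_const (b := (1 : ENNReal)))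
  simp only [Pi.mul_apply, mul_one, ENNReal.one_rpow, lintegral_const, one_mul] at h
  refine (ENNReal.rpow_le_rpow h hq0.le).trans (le_of_eq ?_)
  rw [ENNReal.mul_rpow_of_nonneg _ _ hq0.le, ← ENNReal.rpow_mul, ← ENNReal.rpow_mul]
  congr 2
  · rw [one_div, inv_mul_cancel₀ hq0.ne', ENNReal.rpow_one]
  · rw [Real.conjExponent]
    have : q - 1 ≠ 0 := by linarith
    field_simp

/-- Jensen's inequality with a weight. -/
theorem lintegral_rpow_le_weighted {X : Type*} [MeasurableSpace X] (ν : Measure X)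
    {q : ℝ} (hq : 1 ≤ q) {g h : X → ENNReal} (hg : Measurable g) (hh : Measurable h)
    (h0 : ∀ x, h x ≠ 0) (ht : ∀ x, h x ≠ ⊤) :
    (∫⁻ x, g x ∂ν) ^ q ≤
      (∫⁻ x, g x ^ q * h x ^ (q - 1) ∂ν) * (∫⁻ x, (h x)⁻¹ ∂ν) ^ (q - 1) := by
  -- Jensen for the measure with density `h⁻¹`, applied to `g * h`.
  have key := lintegral_rpow_le_lintegral_rpow_mul (ν.withDensity h⁻¹) hq
    (hg.mul hh).aemeasurable
  rw [withDensity_apply _ MeasurableSet.univ, Measure.restrict_univ,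
    lintegral_withDensity_eq_lintegral_mul _ hh.inv (hg.mul hh),
    lintegral_withDensity_eq_lintegral_mul _ hh.inv ((hg.mul hh).pow_const q)] at key
  simp only [Pi.inv_apply] at key
  convert key using 2
  · congr 1
    funext x
    simp only [Pi.mul_apply, Pi.inv_apply]
    rw [mul_comm, mul_assoc, ENNReal.mul_inv_cancel (h0 x) (ht x), mul_one]
  · refine lintegral_congr fun x => ?_
    simp only [Pi.mul_apply, Pi.inv_apply]
    rw [ENNReal.mul_rpow_of_nonneg _ _ (by linarith), ENNReal.rpow_sub _ _ (h0 x) (ht x),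
      ENNReal.rpow_one, div_eq_mul_inv]
    ring

theorem lintegral_Ioi_rpow {a c : ℝ} (ha : a < -1) (hc : 0 < c) :
    ∫⁻ x in Ioi c, ENNReal.ofReal (x ^ a) = ENNReal.ofReal (-c ^ (a + 1) / (a + 1)) := by
  rw [← integral_Ioi_rpow_of_lt ha hc, ofReal_integral_eq_lintegral_ofReal
    (integrableOn_Ioi_rpow_of_lt ha hc)]
  filter_upwards [self_mem_ae_restrict measurableSet_Ioi] with x hx
  exact Real.rpow_nonneg (hc.trans hx).le _

/-- If `τ` has an `s`-Carleson distribution near `1`, the integral of `(1 - τ r)^{-a}`, `a > s`,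
grows at most like `(1 - r)^{s - a}`. -/
theorem lintegral_one_sub_mul_rpow_le {X : Type*} [MeasurableSpace X] (ν : Measure X) [SFinite ν]
    {τ : X → ℝ} (hτ : Measurable τ) (hτ0 : ∀ᵐ x ∂ν, 0 ≤ τ x) (hτ1 : ∀ᵐ x ∂ν, τ x < 1)
    {C s a : ℝ} (hs : 0 < s) (hsa : s < a)
    (hν : ∀ y, 0 < y → ν {x | 1 - τ x ≤ y} ≤ ENNReal.ofReal (C * y ^ s))
    {r : ℝ} (hr0 : 0 ≤ r) (hr1 : r < 1) :
    ∫⁻ x, ENNReal.ofReal ((1 - τ x * r) ^ (-a)) ∂ν ≤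
      ENNReal.ofReal (C * (a / (a - s))) * ENNReal.ofReal ((1 - r) ^ (s - a)) := by
  have ha : 0 < a := hs.trans hsa
  -- Layer cake: `(1 - τr)^(-a)` is the integral of `a y^(-a-1)` over `y > 1 - τr`. Such `y` exceed
  -- both `1 - r` and `1 - τ`, which decouples `r` from `τ`; after Tonelli only the distribution of
  -- `τ` is left.
  have step : ∀ᵐ x ∂ν, ENNReal.ofReal ((1 - τ x * r) ^ (-a)) ≤
      ∫⁻ y in Ioi (1 - r), {x | 1 - τ x ≤ y}.indicator
        (fun _ => ENNReal.ofReal (a * y ^ (-a - 1))) x := by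
    filter_upwards [hτ0, hτ1] with x h0 h1
    have hpos : 0 < 1 - τ x * r := by nlinarith
    have e1 : ENNReal.ofReal ((1 - τ x * r) ^ (-a)) =
        ∫⁻ y in Ioi (1 - τ x * r), ENNReal.ofReal (a * y ^ (-a - 1)) := by
      simp_rw [ENNReal.ofReal_mul ha.le]
      rw [lintegral_const_mul' _ _ ENNReal.ofReal_ne_top, lintegral_Ioi_rpow (by linarith) hpos,
        ← ENNReal.ofReal_mul ha.le]
      congr 1
      have : -a - 1 + 1 = -a := by ring
      rw [this]
      field_simp
    rw [e1, ← lintegral_indicator measurableSet_Ioi, ← lintegral_indicator measurableSet_Ioi]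
    refine lintegral_mono fun y => ?_
    by_cases hy : y ∈ Ioi (1 - τ x * r)
    · have hy' : 1 - τ x * r < y := hy
      have h2 : y ∈ Ioi (1 - r) := by simp only [mem_Ioi]; nlinarith
      have h3 : x ∈ {x | 1 - τ x ≤ y} := by simp only [mem_ofPred_eq]; nlinarith
      rw [indicator_of_mem hy, indicator_of_mem h2, indicator_of_mem h3]
    · rw [indicator_of_notMem hy]; exact zero_le
  have hset : ∀ y, MeasurableSet {x | 1 - τ x ≤ y} := fun y =>
    measurableSet_le (measurable_const.sub hτ) measurable_const
  have hmeas : Measurable fun z : X × ℝ => {x | 1 - τ x ≤ z.2}.indicator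
        (fun _ => ENNReal.ofReal (a * z.2 ^ (-a - 1))) z.1 := by
    have : (fun z : X × ℝ => {x | 1 - τ x ≤ z.2}.indicator
        (fun _ => ENNReal.ofReal (a * z.2 ^ (-a - 1))) z.1) =
        {z : X × ℝ | 1 - τ z.1 ≤ z.2}.indicator
          (fun z => ENNReal.ofReal (a * z.2 ^ (-a - 1))) := by
      ext z; simp [indicator]
    rw [this]
    refine Measurable.indicator (by fun_prop) (measurableSet_le (by fun_prop) measurable_snd)
  calc ∫⁻ x, ENNReal.ofReal ((1 - τ x * r) ^ (-a)) ∂ν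
      ≤ ∫⁻ x, (∫⁻ y in Ioi (1 - r), {x | 1 - τ x ≤ y}.indicator
        (fun _ => ENNReal.ofReal (a * y ^ (-a - 1))) x) ∂ν := lintegral_mono_ae step
    _ = ∫⁻ y in Ioi (1 - r), ∫⁻ x, {x | 1 - τ x ≤ y}.indicator
        (fun _ => ENNReal.ofReal (a * y ^ (-a - 1))) x ∂ν :=
      lintegral_lintegral_swap hmeas.aemeasurable
    _ = ∫⁻ y in Ioi (1 - r), ENNReal.ofReal (a * y ^ (-a - 1)) * ν {x | 1 - τ x ≤ y} := by
      refine lintegral_congr fun y => ?_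
      rw [lintegral_indicator_const (hset y)]
    _ ≤ ∫⁻ y in Ioi (1 - r), ENNReal.ofReal (C * a) * ENNReal.ofReal (y ^ (s - a - 1)) := by
      refine setLIntegral_mono' measurableSet_Ioi fun y hy => ?_
      have hy0 : 0 < y := lt_trans (by linarith) hy
      refine (mul_le_mul_right (hν y hy0) _).trans (le_of_eq ?_)
      rw [← ENNReal.ofReal_mul (by positivity), ← ENNReal.ofReal_mul' (by positivity)]
      congr 1
      have : s - a - 1 = s + (-a - 1) := by ring
      rw [this, Real.rpow_add hy0]; ring
    _ = _ := by
      rw [lintegral_const_mul' _ _ ENNReal.ofReal_ne_top,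
        lintegral_Ioi_rpow (by linarith) (by linarith)]
      have h1 : 0 < a - s := by linarith
      have h2 : (0 : ℝ) ≤ (1 - r) ^ (s - a) := Real.rpow_nonneg (by linarith) _
      have h3 : -(1 - r) ^ (s - a - 1 + 1) / (s - a - 1 + 1) = (a - s)⁻¹ * (1 - r) ^ (s - a) := by
        have : s - a - 1 + 1 = -(a - s) := by ring
        rw [this, neg_div_neg_eq, neg_sub, div_eq_inv_mul]
      rw [h3, ← ENNReal.ofReal_mul' (by positivity), ← ENNReal.ofReal_mul' h2]
      congr 1
      field_simp

/-! ### Holomorphy of averages of dilations -/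

theorem mul_mem_ball {R : ℝ} {w z : ℂ} (hw : ‖w‖ ≤ 1) (hz : z ∈ Metric.ball (0 : ℂ) R) :
    w * z ∈ Metric.ball (0 : ℂ) R := by
  rw [mem_ball_zero_iff, norm_mul] at *
  nlinarith [norm_nonneg z, norm_nonneg w]

theorem measurable_comp_mul {X : Type*} [MeasurableSpace X] {R : ℝ} {h : ℂ → ℂ}
    (hh : ContinuousOn h (Metric.ball 0 R)) {φ : X → ℂ} (hφ : Measurable φ)
    (hφ1 : ∀ x, ‖φ x‖ ≤ 1) {z : ℂ} (hz : z ∈ Metric.ball (0 : ℂ) R) :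
    Measurable fun x => h (φ x * z) :=
  (continuousOn_iff_continuous_domRestrict.mp hh).measurable.comp
    ((hφ.mul_const z).subtype_mk (h := fun x => mul_mem_ball (hφ1 x) hz))

theorem exists_bound_comp_mul {R : ℝ} {h : ℂ → ℂ} (hh : ContinuousOn h (Metric.ball 0 R))
    {ρ : ℝ} (hρ : ρ < R) : ∃ K, 0 ≤ K ∧ ∀ w z : ℂ, ‖w‖ ≤ 1 → ‖z‖ ≤ ρ → ‖h (w * z)‖ ≤ K := by
  obtain ⟨K, hK⟩ := (isCompact_closedBall (0 : ℂ) ρ).exists_bound_of_continuousOn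
    (hh.mono (Metric.closedBall_subset_ball hρ))
  refine ⟨max K 0, le_max_right _ _, fun w z hw hz => (hK _ ?_).trans (le_max_left _ _)⟩
  rw [mem_closedBall_zero_iff, norm_mul]
  nlinarith [norm_nonneg z, norm_nonneg w]

theorem integrable_comp_mul {X : Type*} [MeasurableSpace X] {ν : Measure X} [IsFiniteMeasure ν]
    {R : ℝ} {h : ℂ → ℂ} (hh : ContinuousOn h (Metric.ball 0 R)) {φ ψ : X → ℂ}
    (hφ : Measurable φ) (hφ1 : ∀ x, ‖φ x‖ ≤ 1) (hψ : Measurable ψ) {M : ℝ}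
    (hψM : ∀ x, ‖ψ x‖ ≤ M) {z : ℂ} (hz : z ∈ Metric.ball (0 : ℂ) R) :
    Integrable (fun x => h (φ x * z) * ψ x) ν := by
  obtain ⟨K, hK0, hK⟩ := exists_bound_comp_mul hh (mem_ball_zero_iff.mp hz)
  refine Integrable.of_bound ((measurable_comp_mul hh hφ hφ1 hz).mul hψ).aestronglyMeasurable
    (K * M) (Filter.Eventually.of_forall fun x => ?_)
  rw [norm_mul]
  exact mul_le_mul (hK _ _ (hφ1 x) le_rfl) (hψM x) (norm_nonneg _) hK0

/-- Serves two purposes: the circle averages in Hardy's theorem (`φ = e^{iθ}`) and the operator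
itself (`φ = t`, `ψ = 1`). Derivatives are dominated on a slightly smaller disc, where `deriv h` is
bounded. -/
theorem differentiableOn_integral_comp_mul {X : Type*} [MeasurableSpace X] {ν : Measure X}
    [IsFiniteMeasure ν] {R : ℝ} {h : ℂ → ℂ} (hh : DifferentiableOn ℂ h (Metric.ball 0 R))
    {φ ψ : X → ℂ} (hφ : Measurable φ) (hφ1 : ∀ x, ‖φ x‖ ≤ 1) (hψ : Measurable ψ) {M : ℝ}
    (hψM : ∀ x, ‖ψ x‖ ≤ M) :
    DifferentiableOn ℂ (fun z => ∫ x, h (φ x * z) * ψ x ∂ν) (Metric.ball 0 R) := by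
  intro z₀ hz₀
  obtain ⟨ρ, hρ1, hρ2⟩ := exists_between (mem_ball_zero_iff.mp hz₀)
  have hd : ContinuousOn (deriv h) (Metric.ball 0 R) := (hh.deriv Metric.isOpen_ball).continuousOn
  obtain ⟨K, hK0, hK⟩ := exists_bound_comp_mul hd hρ2
  have hs : Metric.ball (0 : ℂ) ρ ∈ nhds z₀ :=
    Metric.isOpen_ball.mem_nhds (mem_ball_zero_iff.mpr hρ1)
  have hsub : Metric.ball (0 : ℂ) ρ ⊆ Metric.ball 0 R := Metric.ball_subset_ball hρ2.le
  refine (hasDerivAt_integral_of_dominated_loc_of_deriv_le (bound := fun _ => K * M)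
    (F' := fun z x => deriv h (φ x * z) * φ x * ψ x) hs ?_
    (integrable_comp_mul hh.continuousOn hφ hφ1 hψ hψM hz₀) ?_ ?_ (integrable_const _)
    ?_).2.differentiableAt.differentiableWithinAt
  · filter_upwards [hs] with z hz
    exact (integrable_comp_mul hh.continuousOn hφ hφ1 hψ hψM (hsub hz)).aestronglyMeasurable
  · exact (((measurable_comp_mul hd hφ hφ1 hz₀).mul hφ).mul hψ).aestronglyMeasurable
  · refine Filter.Eventually.of_forall fun x z hz => ?_
    rw [norm_mul, norm_mul]
    have h1 := hK _ _ (hφ1 x) (mem_ball_zero_iff.mp hz).le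
    calc _ ≤ K * 1 * M := mul_le_mul (mul_le_mul h1 (hφ1 x) (norm_nonneg _) hK0) (hψM x)
          (norm_nonneg _) (by positivity)
      _ = K * M := by ring
  · refine Filter.Eventually.of_forall fun x z hz => ?_
    have h1 : HasDerivAt h (deriv h (φ x * z)) (φ x * z) :=
      (hh.differentiableAt (Metric.isOpen_ball.mem_nhds
        (mul_mem_ball (hφ1 x) (hsub hz)))).hasDerivAt
    have h2 : HasDerivAt (fun z => φ x * z) (φ x) z := by
      simpa using (hasDerivAt_id z).const_mul (φ x)
    exact (h1.comp z h2).mul_const (ψ x)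

/-! ### Integral means on circles and Hardy's theorem -/

theorem norm_exp_mul_I (θ : ℝ) : ‖Complex.exp (θ * Complex.I)‖ ≤ 1 :=
  (Complex.norm_exp_ofReal_mul_I θ).le

theorem measurable_exp_mul_I : Measurable fun θ : ℝ => Complex.exp (θ * Complex.I) := by
  fun_prop

/-- The integral mean of `‖f‖ ^ p` along the circle through `z` centred at the origin. -/
noncomputable def circleMean (p : ℝ) (f : ℂ → ℂ) (z : ℂ) : ℝ :=
  ∫ θ in Ioc (-Real.pi) Real.pi, ‖f (Complex.exp (θ * Complex.I) * z)‖ ^ p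

theorem circleMean_mul_exp (p : ℝ) (f : ℂ → ℂ) (r φ : ℝ) :
    circleMean p f (r * Complex.exp (φ * Complex.I)) = circleMean p f r := by
  have hπ : -Real.pi ≤ Real.pi := by linarith [Real.pi_pos]
  unfold circleMean
  rw [← intervalIntegral.integral_of_le hπ, ← intervalIntegral.integral_of_le hπ]
  set k : ℝ → ℝ := fun θ => ‖f (Complex.exp (θ * Complex.I) * r)‖ ^ p with hk
  have hper : Function.Periodic k (2 * Real.pi) := by
    intro θ
    simp only [hk]
    congr 4
    have := Complex.exp_periodic (θ * Complex.I)
    rw [← this]; push_cast; ring_nf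
  have h1 : ∀ θ : ℝ, ‖f (Complex.exp (θ * Complex.I) * (r * Complex.exp (φ * Complex.I)))‖ ^ p =
      k (θ + φ) := by
    intro θ
    simp only [hk]
    congr 3
    push_cast
    rw [add_mul, Complex.exp_add]; ring
  simp_rw [h1]
  rw [intervalIntegral.integral_comp_add_right]
  have := hper.intervalIntegral_add_eq (-Real.pi + φ) (-Real.pi)
  convert this using 2 <;> ring

theorem integrable_norm_rpow_circle {p : ℝ} (hp : 0 ≤ p) {R : ℝ} {f : ℂ → ℂ}
    (hf : ContinuousOn f (Metric.ball 0 R)) {z : ℂ} (hz : z ∈ Metric.ball (0 : ℂ) R) :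
    IntegrableOn (fun θ : ℝ => ‖f (Complex.exp (θ * Complex.I) * z)‖ ^ p)
      (Ioc (-Real.pi) Real.pi) := by
  obtain ⟨K, hK0, hK⟩ := exists_bound_comp_mul hf (mem_ball_zero_iff.mp hz)
  refine Integrable.of_bound ((measurable_comp_mul hf measurable_exp_mul_I norm_exp_mul_I
    hz).norm.pow_const p).aestronglyMeasurable (K ^ p) (Filter.Eventually.of_forall fun θ => ?_)
  rw [Real.norm_of_nonneg (by positivity)]
  exact Real.rpow_le_rpow (norm_nonneg _) (hK _ _ (norm_exp_mul_I θ) le_rfl) hp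

/-- Hardy's theorem: the integral means of a holomorphic function increase with the radius. -/
theorem circleMean_mono {p : ℝ} (hp : 1 ≤ p) {R : ℝ} {f : ℂ → ℂ}
    (hf : DifferentiableOn ℂ f (Metric.ball 0 R)) {r r' : ℝ} (hr : 0 ≤ r) (hrr : r ≤ r')
    (hr' : r' < R) : circleMean p f r ≤ circleMean p f r' := by
  have hp0 : 0 < p := by linarith
  have hr'0 : 0 ≤ r' := hr.trans hrr
  have hrR : (r : ℂ) ∈ Metric.ball (0 : ℂ) R := by
    rw [mem_ball_zero_iff, Complex.norm_real, Real.norm_of_nonneg hr]; linarith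
  obtain ⟨K, hK0, hK⟩ := exists_bound_comp_mul hf.continuousOn (mem_ball_zero_iff.mp hrR)
  set e : ℝ → ℂ := fun θ => Complex.exp (θ * Complex.I) with he
  set ν : Measure ℝ := volume.restrict (Ioc (-Real.pi) Real.pi) with hν
  -- The function dual to `f` on the circle of radius `r`: pairing with it makes the holomorphic `F`
  -- take the value `M(r)` at `r`, and the maximum principle for `F` replaces subharmonicity of
  -- `|f|^p`.
  set ψ : ℝ → ℂ := fun θ =>
    (starRingEnd ℂ) (f (e θ * r)) * ((‖f (e θ * r)‖ ^ (p - 2) : ℝ) : ℂ) with hψ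
  have hfm : Measurable fun θ => f (e θ * r) :=
    measurable_comp_mul hf.continuousOn measurable_exp_mul_I norm_exp_mul_I hrR
  have hψm : Measurable ψ := by
    refine Measurable.mul (Complex.continuous_conj.measurable.comp hfm) ?_
    exact Complex.measurable_ofReal.comp (hfm.norm.pow_const _)
  -- Only an inequality: for `p = 1` and at a zero of `f`, the left side is `0` and the right side
  -- is `0 ^ 0 = 1`.
  have hψn : ∀ θ, ‖ψ θ‖ ≤ ‖f (e θ * r)‖ ^ (p - 1) := by
    intro θ
    simp only [hψ, norm_mul, RCLike.norm_conj, Complex.norm_real]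
    rw [Real.norm_of_nonneg (by positivity)]
    rcases eq_or_ne (f (e θ * r)) 0 with h | h
    · rw [h]; simp only [norm_zero, zero_mul]; positivity
    · have : p - 1 = 1 + (p - 2) := by ring
      rw [this, Real.rpow_add (norm_pos_iff.mpr h), Real.rpow_one]
  have hψM : ∀ θ, ‖ψ θ‖ ≤ K ^ (p - 1) := fun θ => (hψn θ).trans
    (Real.rpow_le_rpow (norm_nonneg _) (hK _ _ (norm_exp_mul_I θ) le_rfl) (by linarith))
  set F : ℂ → ℂ := fun z => ∫ θ, f (e θ * z) * ψ θ ∂ν with hF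
  have hFd : DifferentiableOn ℂ F (Metric.ball 0 R) :=
    differentiableOn_integral_comp_mul hf measurable_exp_mul_I norm_exp_mul_I hψm hψM
  have hFr : F r = ((circleMean p f r : ℝ) : ℂ) := by
    simp only [hF, circleMean]
    rw [← integral_complex_ofReal]
    refine integral_congr_ae (Filter.Eventually.of_forall fun θ => ?_)
    simp only [hψ]
    rw [← mul_assoc, Complex.mul_conj, ← Complex.ofReal_mul, Complex.normSq_eq_norm_sq]
    congr 1
    rcases eq_or_ne (f (e θ * r)) 0 with h | h
    · rw [h]; simp [Real.zero_rpow hp0.ne']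
    · rw [← Real.rpow_natCast, ← Real.rpow_add (norm_pos_iff.mpr h)]
      simp [he]
  have hA : 0 ≤ circleMean p f r := integral_nonneg fun θ => by positivity
  -- Young's inequality with weights `1/p` and `1 - 1/p`, which includes `p = 1`. The resulting
  -- multiple of `M(r)` is absorbed at the end.
  have hbd : ∀ z : ℂ, ‖z‖ = r' →
      ‖F z‖ ≤ (1 / p) * circleMean p f r' + (1 - 1 / p) * circleMean p f r := by
    intro z hz
    have hzR : z ∈ Metric.ball (0 : ℂ) R := by rw [mem_ball_zero_iff]; linarith
    have hcz : circleMean p f z = circleMean p f r' := by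
      rw [← circleMean_mul_exp p f r' z.arg, ← hz, Complex.norm_mul_exp_arg_mul_I]
    have i1 := integrable_norm_rpow_circle hp0.le hf.continuousOn hzR
    have i2 := integrable_norm_rpow_circle hp0.le hf.continuousOn hrR
    rw [← hcz]
    simp only [hF, circleMean]
    rw [← integral_const_mul, ← integral_const_mul, ← integral_add (i1.const_mul _)
      (i2.const_mul _)]
    refine norm_integral_le_of_norm_le ((i1.const_mul _).add (i2.const_mul _))
      (Filter.Eventually.of_forall fun θ => ?_)
    rw [norm_mul]
    have hinv : 1 / p ≤ 1 := by rw [div_le_one hp0]; exact hp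
    have am := Real.geom_mean_le_arith_mean2_weighted (w₁ := 1 / p) (w₂ := 1 - 1 / p)
      (p₁ := ‖f (e θ * z)‖ ^ p) (p₂ := ‖f (e θ * r)‖ ^ p) (by positivity) (by linarith)
      (by positivity) (by positivity) (by ring)
    rw [← Real.rpow_mul (norm_nonneg _), ← Real.rpow_mul (norm_nonneg _),
      mul_one_div_cancel hp0.ne', Real.rpow_one, mul_sub, mul_one_div_cancel hp0.ne',
      mul_one] at am
    exact (mul_le_mul_of_nonneg_left (hψn θ) (norm_nonneg _)).trans am
  have hmax : ‖F r‖ ≤ (1 / p) * circleMean p f r' + (1 - 1 / p) * circleMean p f r := by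
    rcases hrr.eq_or_lt with h | h
    · exact hbd r (by rw [Complex.norm_real, Real.norm_of_nonneg hr, h])
    refine Complex.norm_le_of_forall_mem_frontier_norm_le (U := Metric.ball (0 : ℂ) r')
      Metric.isBounded_ball ?_ ?_ (subset_closure ?_)
    · refine (hFd.mono ?_).diffContOnCl
      exact Metric.closure_ball_subset_closedBall.trans (Metric.closedBall_subset_ball hr')
    · intro z hz
      refine hbd z ?_
      have := Metric.frontier_ball_subset_sphere hz
      simpa using this
    · rw [mem_ball_zero_iff, Complex.norm_real, Real.norm_of_nonneg hr]; exact h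
  rw [hFr, Complex.norm_real, Real.norm_of_nonneg hA] at hmax
  have h1 : 0 < 1 / p := by positivity
  have h2 : (1 / p) * circleMean p f r ≤ (1 / p) * circleMean p f r' := by linarith
  exact le_of_mul_le_mul_left h2 h1

/-! ### Polar coordinates and radial weights -/

theorem lintegral_eq_polar {g : ℂ → ENNReal} (hg : Measurable g) :
    ∫⁻ z, g z = ∫⁻ r in Ioi (0 : ℝ), ENNReal.ofReal r *
      ∫⁻ θ in Ioc (-Real.pi) Real.pi, g (Complex.exp (θ * Complex.I) * r) := by
  have hpol : ∀ x : ℝ × ℝ, Complex.polarCoord.symm x = Complex.exp (x.2 * Complex.I) * x.1 := by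
    intro x
    rw [Complex.polarCoord_symm_apply, Complex.exp_mul_I, ← Complex.ofReal_cos,
      ← Complex.ofReal_sin, mul_comm]
  rw [← Complex.lintegral_comp_polarCoord_symm]
  simp_rw [hpol]
  have ht : polarCoord.target = Ioi (0 : ℝ) ×ˢ Ioo (-Real.pi) Real.pi := rfl
  have hm : Measurable fun x : ℝ × ℝ =>
      ENNReal.ofReal x.1 • g (Complex.exp (x.2 * Complex.I) * x.1) := by
    simp only [smul_eq_mul]
    refine Measurable.mul (by fun_prop) (hg.comp (by fun_prop))
  rw [ht, Measure.volume_eq_prod, ← Measure.prod_restrict, lintegral_prod _ hm.aemeasurable]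
  refine lintegral_congr fun r => ?_
  simp only [smul_eq_mul]
  rw [lintegral_const_mul' _ _ ENNReal.ofReal_ne_top, restrict_Ioo_eq_restrict_Ioc]

theorem measurable_indicator_ball {R : ℝ} {f : ℂ → ℂ} (hf : ContinuousOn f (Metric.ball 0 R)) :
    Measurable ((Metric.ball (0 : ℂ) R).indicator f) := by
  classical
  have := hf.measurable_piecewise (g := 0) continuousOn_const measurableSet_ball
  rwa [piecewise_eq_indicator] at this

theorem norm_exp_mul_ofReal {r : ℝ} (hr : 0 ≤ r) (θ : ℝ) :
    ‖Complex.exp (θ * Complex.I) * r‖ = r := by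
  rw [norm_mul, Complex.norm_exp_ofReal_mul_I, one_mul, Complex.norm_real, Real.norm_of_nonneg hr]

theorem ofReal_circleMean {p : ℝ} (hp : 0 ≤ p) {R : ℝ} {f : ℂ → ℂ}
    (hf : ContinuousOn f (Metric.ball 0 R)) {r : ℝ} (hr : 0 ≤ r) (hrR : r < R) :
    ENNReal.ofReal (circleMean p f r) = ∫⁻ θ in Ioc (-Real.pi) Real.pi,
      ENNReal.ofReal (‖f (Complex.exp (θ * Complex.I) * r)‖ ^ p) := by
  refine ofReal_integral_eq_lintegral_ofReal (integrable_norm_rpow_circle hp hf ?_)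
    (Filter.Eventually.of_forall fun θ => by positivity)
  rwa [mem_ball_zero_iff, Complex.norm_real, Real.norm_of_nonneg hr]

/-- Polar coordinates for `|f|^p` against a radial weight on a disc. -/
theorem lintegral_ball_norm_rpow {p : ℝ} (hp : 0 ≤ p) {R : ℝ} {f : ℂ → ℂ}
    (hf : ContinuousOn f (Metric.ball 0 R)) {w : ℝ → ENNReal} (hw : Measurable w) :
    ∫⁻ z in Metric.ball (0 : ℂ) R, ENNReal.ofReal (‖f z‖ ^ p) * w ‖z‖ =
      ∫⁻ r in Ioo 0 R, ENNReal.ofReal r * (ENNReal.ofReal (circleMean p f r) * w r) := by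
  set B := Metric.ball (0 : ℂ) R with hB
  have e1 : ∫⁻ z in B, ENNReal.ofReal (‖f z‖ ^ p) * w ‖z‖ =
      ∫⁻ z, B.indicator (fun z => ENNReal.ofReal (‖B.indicator f z‖ ^ p) * w ‖z‖) z := by
    rw [lintegral_indicator measurableSet_ball]
    refine setLIntegral_congr_fun measurableSet_ball fun z hz => ?_
    simp only [indicator_of_mem hz]
  have hm : Measurable (B.indicator (fun z => ENNReal.ofReal (‖B.indicator f z‖ ^ p) * w ‖z‖)) := by
    refine Measurable.indicator (Measurable.mul ?_ (hw.comp measurable_norm)) measurableSet_ball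
    exact ENNReal.measurable_ofReal.comp ((measurable_indicator_ball hf).norm.pow_const p)
  rw [e1, lintegral_eq_polar hm, ← lintegral_indicator measurableSet_Ioi,
    ← lintegral_indicator measurableSet_Ioo]
  refine lintegral_congr fun r => ?_
  by_cases hr : r ∈ Ioi (0 : ℝ)
  · rw [indicator_of_mem hr]
    by_cases hrR : r < R
    · rw [indicator_of_mem (show r ∈ Ioo 0 R from ⟨hr, hrR⟩), ofReal_circleMean hp hf
        (le_of_lt hr) hrR]
      congr 1
      have hmem : ∀ θ : ℝ, Complex.exp (θ * Complex.I) * r ∈ B := fun θ => by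
        rw [hB, mem_ball_zero_iff, norm_exp_mul_ofReal (le_of_lt hr)]; exact hrR
      simp_rw [indicator_of_mem (hmem _), norm_exp_mul_ofReal (le_of_lt hr)]
      refine lintegral_mul_const _ ?_
      refine ENNReal.measurable_ofReal.comp (Measurable.pow_const (Measurable.norm ?_) p)
      refine measurable_comp_mul hf measurable_exp_mul_I norm_exp_mul_I ?_
      rwa [mem_ball_zero_iff, Complex.norm_real, Real.norm_of_nonneg (le_of_lt hr)]
    · have hmem : ∀ θ : ℝ, Complex.exp (θ * Complex.I) * r ∉ B := fun θ => by
        rw [hB, mem_ball_zero_iff, norm_exp_mul_ofReal (le_of_lt hr)]; exact hrR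
      rw [indicator_of_notMem (show r ∉ Ioo 0 R from fun h => hrR h.2)]
      simp_rw [indicator_of_notMem (hmem _)]
      simp
  · rw [indicator_of_notMem hr, indicator_of_notMem fun h => hr h.1]

/-- Two-sided comparability is needed because `α` may have either sign; each sign uses one of the
two bounds. -/
theorem rpow_le_of_comparable (α : ℝ) {d x : ℝ} (hd : 0 < d) (h1 : d ≤ 4 * x) (h2 : x ≤ 4 * d) :
    d ^ α ≤ 4 ^ |α| * x ^ α := by
  have hx : 0 < x := by linarith
  rcases le_total 0 α with h | h
  · rw [abs_of_nonneg h, ← Real.mul_rpow (by norm_num) hx.le]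
    exact Real.rpow_le_rpow hd.le h1 h
  · rw [abs_of_nonpos h]
    have h3 : (4 * d) ^ α ≤ x ^ α := Real.rpow_le_rpow_of_nonpos hx h2 h
    rw [Real.mul_rpow (by norm_num) hd.le] at h3
    calc d ^ α = 4 ^ (-α) * (4 ^ α * d ^ α) := by
          rw [← mul_assoc, ← Real.rpow_add (by norm_num)]; simp
      _ ≤ _ := mul_le_mul_of_nonneg_left h3 (by positivity)

theorem lintegral_diskArea_lt_top_iff (g : ℂ → ENNReal) :
    ∫⁻ z, g z ∂diskArea < ⊤ ↔ ∫⁻ z in Metric.ball (0 : ℂ) 1, g z < ⊤ := by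
  rw [diskArea, lintegral_smul_measure, smul_eq_mul]
  have : ENNReal.ofReal Real.pi⁻¹ ≠ 0 := by
    simp [Real.pi_pos]
  constructor
  · intro h; exact ENNReal.lt_top_of_mul_ne_top_right h.ne this
  · intro h; exact ENNReal.mul_lt_top ENNReal.ofReal_lt_top h

theorem lintegral_circleMean_lt_top {p α : ℝ} (hp : 0 ≤ p) {f : ℂ → ℂ}
    (hf : f ∈ bergmanSpace p α) :
    ∫⁻ r in Ioo (0 : ℝ) 1, ENNReal.ofReal r *
      (ENNReal.ofReal (circleMean p f r) * ENNReal.ofReal ((1 - r ^ 2) ^ α)) < ⊤ := by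
  have h := (lintegral_diskArea_lt_top_iff _).mp hf.2
  simp_rw [ENNReal.ofReal_mul (Real.rpow_nonneg (norm_nonneg _) p)] at h
  rwa [lintegral_ball_norm_rpow hp hf.1.continuousOn (w := fun r => ENNReal.ofReal ((1 - r ^ 2) ^ α))
    (by fun_prop)] at h

/-! ### Sub-mean value property and pointwise growth -/

/-- The sub-mean value property of `|f|^p` on discs. -/
theorem norm_rpow_mul_le_lintegral_ball {p : ℝ} (hp : 1 ≤ p) {f : ℂ → ℂ} {z : ℂ} {R R' : ℝ}
    (hR : 0 ≤ R) (hRR' : R ≤ R') (hf : DifferentiableOn ℂ f (Metric.ball z R')) :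
    ENNReal.ofReal (Real.pi * R ^ 2 * ‖f z‖ ^ p) ≤
      ∫⁻ w in Metric.ball z R, ENNReal.ofReal (‖f w‖ ^ p) := by
  set h : ℂ → ℂ := fun w => f (z + w) with hh
  have hd : DifferentiableOn ℂ h (Metric.ball 0 R') := by
    refine hf.comp (by fun_prop) fun w hw => ?_
    simpa using hw
  have e1 : ∫⁻ w in Metric.ball z R, ENNReal.ofReal (‖f w‖ ^ p) =
      ∫⁻ w in Metric.ball 0 R, ENNReal.ofReal (‖h w‖ ^ p) * 1 := by
    rw [← lintegral_indicator measurableSet_ball, ← lintegral_indicator measurableSet_ball,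
      ← lintegral_add_left_eq_self _ z]
    refine lintegral_congr fun w => ?_
    simp [indicator, hh]
  rw [e1, lintegral_ball_norm_rpow (by linarith)
    (hd.continuousOn.mono (Metric.ball_subset_ball hRR')) (w := fun _ => 1) measurable_const]
  -- The mean at radius `0` is the value at the centre, and by Hardy's theorem every other mean
  -- dominates it; integrate against `r dr`.
  have h0 : circleMean p h (0 : ℝ) = 2 * Real.pi * ‖f z‖ ^ p := by
    simp only [circleMean, hh]
    simp [Real.pi_pos.le, ← two_mul]
  have e2 : ENNReal.ofReal (Real.pi * R ^ 2 * ‖f z‖ ^ p) =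
      ∫⁻ r in Ioo 0 R, ENNReal.ofReal (r * circleMean p h (0 : ℝ)) := by
    rw [restrict_Ioo_eq_restrict_Ioc, ← ofReal_integral_eq_lintegral_ofReal]
    · rw [← intervalIntegral.integral_of_le hR, intervalIntegral.integral_mul_const, integral_id, h0]
      congr 1; ring
    · exact (Continuous.integrableOn_Ioc (by fun_prop))
    · filter_upwards [self_mem_ae_restrict measurableSet_Ioc] with r hr
      rw [h0]
      have := hr.1.le
      simp only [Pi.zero_apply]; positivity
  rw [e2]
  refine setLIntegral_mono' measurableSet_Ioo fun r hr => ?_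
  rw [ENNReal.ofReal_mul hr.1.le, mul_one]
  refine mul_le_mul_right (ENNReal.ofReal_le_ofReal ?_) _
  exact circleMean_mono hp hd le_rfl hr.1.le (hr.2.trans_le hRR')

/-- Pointwise growth of functions in a weighted Bergman space. -/
theorem exists_growth_bound {p α : ℝ} (hp : 1 ≤ p) {f : ℂ → ℂ} (hf : f ∈ bergmanSpace p α) :
    ∃ C, 0 ≤ C ∧ ∀ z ∈ Metric.ball (0 : ℂ) 1, ‖f z‖ ≤ C * (1 - ‖z‖) ^ (-((α + 2) / p)) := by
  have hp0 : 0 < p := by linarith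
  have hfin := (lintegral_diskArea_lt_top_iff _).mp hf.2
  set A := ∫⁻ z in Metric.ball (0 : ℂ) 1, ENNReal.ofReal (‖f z‖ ^ p * (1 - ‖z‖ ^ 2) ^ α) with hA
  set K : ℝ := 4 / Real.pi * 4 ^ |α| * A.toReal with hK
  have hK0 : 0 ≤ K := by positivity
  refine ⟨K ^ (1 / p), by positivity, fun z hz => ?_⟩
  rw [mem_ball_zero_iff] at hz
  set d := 1 - ‖z‖ with hd
  have hd0 : 0 < d := by linarith
  have hsub : Metric.ball z d ⊆ Metric.ball 0 1 := by
    refine Metric.ball_subset_ball' ?_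
    rw [dist_zero_right]; linarith
  have hsub' : Metric.ball z (d / 2) ⊆ Metric.ball 0 1 :=
    (Metric.ball_subset_ball (by linarith)).trans hsub
  -- On the disc of half the distance to the boundary, `1 - |w|²` is comparable to `d`, so the
  -- weight can be treated as the constant `d ^ α`.
  have key := norm_rpow_mul_le_lintegral_ball hp (R := d / 2) (R' := d) (by linarith) (by linarith)
    (hf.1.mono hsub)
  have h1 : ENNReal.ofReal (d ^ α) * ∫⁻ w in Metric.ball z (d / 2), ENNReal.ofReal (‖f w‖ ^ p) ≤
      ENNReal.ofReal (4 ^ |α|) * A := by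
    rw [hA, ← lintegral_const_mul' _ _ ENNReal.ofReal_ne_top,
      ← lintegral_const_mul' _ _ ENNReal.ofReal_ne_top]
    refine le_trans (setLIntegral_mono' measurableSet_ball fun w hw => ?_)
      (lintegral_mono_set hsub')
    rw [← ENNReal.ofReal_mul (by positivity), ← ENNReal.ofReal_mul (by positivity)]
    refine ENNReal.ofReal_le_ofReal ?_
    rw [mem_ball_iff_norm] at hw
    have hn1 := norm_sub_norm_le w z
    have hn2 := norm_sub_norm_le z w
    rw [norm_sub_rev] at hn2
    have hn := norm_nonneg w
    have := rpow_le_of_comparable α (x := 1 - ‖w‖ ^ 2) hd0 (by nlinarith) (by nlinarith)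
    calc _ ≤ 4 ^ |α| * (1 - ‖w‖ ^ 2) ^ α * ‖f w‖ ^ p :=
          mul_le_mul_of_nonneg_right this (by positivity)
      _ = _ := by ring
  have h2 : ENNReal.ofReal (d ^ α * (Real.pi * (d / 2) ^ 2 * ‖f z‖ ^ p)) ≤
      ENNReal.ofReal (4 ^ |α| * A.toReal) := by
    rw [ENNReal.ofReal_mul (p := d ^ α) (by positivity),
      ENNReal.ofReal_mul (p := 4 ^ |α|) (by positivity), ENNReal.ofReal_toReal hfin.ne]
    exact (mul_le_mul_right key _).trans h1
  rw [ENNReal.ofReal_le_ofReal_iff (by positivity)] at h2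
  have h3 : ‖f z‖ ^ p ≤ K * d ^ (-(α + 2)) := by
    have e : d ^ (-(α + 2)) = (d ^ α * d ^ 2)⁻¹ := by
      rw [Real.rpow_neg hd0.le, Real.rpow_add hd0]; norm_cast
    rw [e, ← div_eq_mul_inv, le_div_iff₀ (by positivity), hK]
    have hpi := Real.pi_pos
    have : 4 / Real.pi * 4 ^ |α| * A.toReal = 4 / Real.pi * (4 ^ |α| * A.toReal) := by ring
    rw [this]
    calc _ = 4 / Real.pi * (d ^ α * (Real.pi * (d / 2) ^ 2 * ‖f z‖ ^ p)) := by field_simp; ring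
      _ ≤ _ := mul_le_mul_of_nonneg_left h2 (by positivity)
  calc ‖f z‖ = (‖f z‖ ^ p) ^ (1 / p) := by
        rw [← Real.rpow_mul (norm_nonneg _), mul_one_div_cancel hp0.ne', Real.rpow_one]
    _ ≤ (K * d ^ (-(α + 2))) ^ (1 / p) := Real.rpow_le_rpow (by positivity) h3 (by positivity)
    _ = _ := by
        rw [Real.mul_rpow hK0 (by positivity), ← Real.rpow_mul hd0.le]
        congr 2; ring

/-! ### The Hardy-type double integral -/

theorem lintegral_Ico_one_sub_rpow {η y : ℝ} (hη : 0 < η) (hy : 0 < y) :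
    ∫⁻ r in Ico (1 - y) 1, ENNReal.ofReal ((1 - r) ^ (η - 1)) = ENNReal.ofReal (y ^ η / η) := by
  have hi : IntervalIntegrable (fun x : ℝ => (1 - x) ^ (η - 1)) volume (1 - y) 1 := by
    have := (intervalIntegral.intervalIntegrable_rpow' (a := y) (b := 0)
      (show -1 < η - 1 by linarith)).comp_sub_left 1
    simpa using this
  have h1 : ∫ r in (1 - y)..1, (1 - r) ^ (η - 1) = y ^ η / η := by
    rw [intervalIntegral.integral_comp_sub_left (fun x => x ^ (η - 1)) 1,
      integral_rpow (Or.inl (by linarith))]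
    simp [Real.zero_rpow hη.ne']
  rw [← h1, intervalIntegral.integral_of_le (by linarith),
    ofReal_integral_eq_lintegral_ofReal ((intervalIntegrable_iff_integrableOn_Ioc_of_le
      (by linarith)).mp hi), Measure.restrict_congr_set Ico_ae_eq_Ioc]
  filter_upwards [self_mem_ae_restrict measurableSet_Ioc] with r hr
  exact Real.rpow_nonneg (by linarith [hr.2]) _

theorem lintegral_one_sub_rpow_indicator_le {η y : ℝ} (hη : 0 < η) (hy : 0 < y) :
    ∫⁻ r in Ioo (0 : ℝ) 1, {r : ℝ | 1 - r ≤ y}.indicator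
      (fun r => ENNReal.ofReal ((1 - r) ^ (η - 1))) r ≤ ENNReal.ofReal (y ^ η / η) := by
  rw [← lintegral_Ico_one_sub_rpow hη hy, ← lintegral_indicator measurableSet_Ioo,
    ← lintegral_indicator measurableSet_Ico]
  refine lintegral_mono fun r => ?_
  by_cases h : r ∈ Ioo (0 : ℝ) 1
  · rw [indicator_of_mem h]
    by_cases h2 : 1 - r ≤ y
    · rw [indicator_of_mem (show r ∈ {r : ℝ | 1 - r ≤ y} from h2),
        indicator_of_mem (show r ∈ Ico (1 - y) 1 from ⟨by linarith, h.2⟩)]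
    · rw [indicator_of_notMem (show r ∉ {r : ℝ | 1 - r ≤ y} from h2)]; exact zero_le
  · rw [indicator_of_notMem h]; exact zero_le

theorem circleMean_nonneg (p : ℝ) (f : ℂ → ℂ) (z : ℂ) : 0 ≤ circleMean p f z :=
  integral_nonneg fun θ => by positivity

theorem measurable_indicator_one_sub_le {X : Type*} [MeasurableSpace X] {τ : X → ℝ}
    (hτ : Measurable τ) {k : X → ENNReal} (hk : Measurable k) :
    Measurable fun x : X × ℝ => {y | 1 - τ y ≤ 4 * (1 - x.2)}.indicator k x.1 := by
  have : (fun x : X × ℝ => {y | 1 - τ y ≤ 4 * (1 - x.2)}.indicator k x.1) =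
      {x : X × ℝ | 1 - τ x.1 ≤ 4 * (1 - x.2)}.indicator (fun x => k x.1) := by
    ext x; simp [indicator]
  rw [this]
  exact (hk.comp measurable_fst).indicator (measurableSet_le (by fun_prop) (by fun_prop))

/-- Integral means are dominated by their averages over a hyperbolic neighbourhood closer to the
boundary. -/
theorem one_sub_rpow_mul_circleMean_le {p : ℝ} (hp : 1 ≤ p) {f : ℂ → ℂ}
    (hf : DifferentiableOn ℂ f (Metric.ball 0 1)) (E : ℝ) {ρ : ℝ} (h0 : 0 ≤ ρ) (h1 : ρ < 1) :
    ENNReal.ofReal ((1 - ρ) ^ E * circleMean p f ρ) ≤ ENNReal.ofReal (4 * 4 ^ |E - 1|) *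
      ∫⁻ u in Ico (1 / 2 : ℝ) 1, {u : ℝ | 1 - ρ ≤ 4 * (1 - u)}.indicator
        (fun u : ℝ => ENNReal.ofReal ((1 - u) ^ (E - 1) * circleMean p f u)) u := by
  have hd : 0 < 1 - ρ := by linarith
  have hM := circleMean_nonneg p f
  -- `I` has length `(1 - ρ)/4`, whence the factor `4`. On it `ρ ≤ u` and `1 - u` lies between `(1 -
  -- ρ)/4` and `(1 - ρ)/2`, and `u ≥ 1/2`.
  set I := Icc ((1 + ρ) / 2) ((3 + ρ) / 4) with hI
  have e1 : ENNReal.ofReal ((1 - ρ) ^ E * circleMean p f ρ) =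
      ∫⁻ _ in I, ENNReal.ofReal (4 * ((1 - ρ) ^ (E - 1) * circleMean p f ρ)) := by
    rw [setLIntegral_const, hI, Real.volume_Icc,
      ← ENNReal.ofReal_mul (by have := hM ρ; positivity)]
    congr 1
    rw [Real.rpow_sub_one hd.ne']
    field_simp
    ring
  rw [e1, ← lintegral_const_mul' _ _ ENNReal.ofReal_ne_top]
  have hsub : I ⊆ Ico (1 / 2) 1 := fun u hu => ⟨by linarith [hu.1], by linarith [hu.2]⟩
  refine le_trans (setLIntegral_mono' measurableSet_Icc fun u hu => ?_) (lintegral_mono_set hsub)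
  have hu1 := hu.1
  have hu2 := hu.2
  rw [indicator_of_mem (show u ∈ {u : ℝ | 1 - ρ ≤ 4 * (1 - u)} from by
    simp only [mem_ofPred_eq]; linarith), ← ENNReal.ofReal_mul (by positivity)]
  refine ENNReal.ofReal_le_ofReal ?_
  have k1 := rpow_le_of_comparable (E - 1) (x := 1 - u) hd (by linarith) (by linarith)
  have k2 := circleMean_mono hp hf h0 (show ρ ≤ u by linarith) (show u < 1 by linarith)
  have k3 : (0 : ℝ) ≤ (1 - u) ^ (E - 1) := Real.rpow_nonneg (by linarith) _
  calc _ ≤ 4 * (4 ^ |E - 1| * (1 - u) ^ (E - 1) * circleMean p f u) := by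
        refine mul_le_mul_of_nonneg_left (mul_le_mul k1 k2 (hM _) (by positivity)) (by norm_num)
    _ = _ := by ring

/-- Monotonicity in the radius yields measurability directly. -/
theorem aemeasurable_circleMean {p : ℝ} (hp : 1 ≤ p) {f : ℂ → ℂ}
    (hf : DifferentiableOn ℂ f (Metric.ball 0 1)) :
    AEMeasurable (fun u : ℝ => circleMean p f u) (volume.restrict (Ico (1 / 2) 1)) := by
  refine aemeasurable_restrict_of_monotoneOn measurableSet_Ico fun x hx y hy hxy => ?_
  exact circleMean_mono hp hf (by linarith [hx.1]) hxy hy.2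

/-- Away from the origin the polar Jacobian `u` is at least `1/2`, and `1 - u²` is comparable to `1
- u`. -/
theorem lintegral_one_sub_rpow_circleMean_lt_top {p α : ℝ} (hp : 1 ≤ p) {f : ℂ → ℂ}
    (hf : f ∈ bergmanSpace p α) :
    ∫⁻ u in Ico (1 / 2 : ℝ) 1, ENNReal.ofReal ((1 - u) ^ α * circleMean p f u) < ⊤ := by
  have h := lintegral_circleMean_lt_top (by linarith) hf
  refine lt_of_le_of_lt ?_ (ENNReal.mul_lt_top
    (ENNReal.ofReal_lt_top (r := 2 * 4 ^ |α|)) h)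
  rw [← lintegral_const_mul' _ _ ENNReal.ofReal_ne_top]
  have hsub : Ico (1 / 2 : ℝ) 1 ⊆ Ioo 0 1 := fun u hu => ⟨by linarith [hu.1], hu.2⟩
  refine le_trans (setLIntegral_mono' measurableSet_Ico fun u hu => ?_) (lintegral_mono_set hsub)
  have hu1 := hu.1
  have hu2 := hu.2
  have hM := circleMean_nonneg p f u
  rw [← ENNReal.ofReal_mul hM, ← ENNReal.ofReal_mul (by linarith),
    ← ENNReal.ofReal_mul (by positivity)]
  refine ENNReal.ofReal_le_ofReal ?_
  have k1 := rpow_le_of_comparable α (d := 1 - u) (x := 1 - u ^ 2) (by linarith) (by nlinarith)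
    (by nlinarith)
  have k2 : (0 : ℝ) ≤ (1 - u ^ 2) ^ α := Real.rpow_nonneg (by nlinarith) _
  calc _ ≤ 4 ^ |α| * (1 - u ^ 2) ^ α * circleMean p f u := mul_le_mul_of_nonneg_right k1 hM
    _ = 1 * (4 ^ |α| * (1 - u ^ 2) ^ α * circleMean p f u) := by ring
    _ ≤ (2 * u) * (4 ^ |α| * (1 - u ^ 2) ^ α * circleMean p f u) :=
        mul_le_mul_of_nonneg_right (by linarith) (by positivity)
    _ = _ := by ring

/-- The two-variable Hardy-type estimate behind the Carleson condition. -/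
theorem lintegral_lintegral_circleMean_lt_top {μ : Measure (Ico (0 : ℝ) 1)} [SFinite μ]
    {C s : ℝ} (hμ : ∀ y, 0 < y → μ {t | 1 - (t : ℝ) ≤ y} ≤ ENNReal.ofReal (C * y ^ s))
    {p α : ℝ} (hp : 1 ≤ p) {f : ℂ → ℂ} (hf : f ∈ bergmanSpace p α) {η E : ℝ} (hη : 0 < η)
    (hE : E - 1 + s + η = α) :
    ∫⁻ t, (∫⁻ r in Ioo (0 : ℝ) 1, ENNReal.ofReal ((1 - r) ^ (η - 1)) *
      ENNReal.ofReal ((1 - (t : ℝ) * r) ^ E * circleMean p f (((t : ℝ) * r : ℝ) : ℂ))) ∂μ < ⊤ := by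
  set D : ℝ → ENNReal := fun u => ENNReal.ofReal ((1 - u) ^ (E - 1) * circleMean p f u) with hD
  set A : ℝ → ℝ → ENNReal := fun r u => {r : ℝ | 1 - r ≤ 4 * (1 - u)}.indicator
    (fun r => ENNReal.ofReal ((1 - r) ^ (η - 1))) r with hA
  set B : Ico (0 : ℝ) 1 → ℝ → ENNReal := fun t u =>
    {t : Ico (0 : ℝ) 1 | 1 - (t : ℝ) ≤ 4 * (1 - u)}.indicator (fun _ => 1) t with hB
  have hDm : AEMeasurable D (volume.restrict (Ico (1 / 2) 1)) :=
    ENNReal.measurable_ofReal.comp_aemeasurable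
      (AEMeasurable.mul (by fun_prop) (aemeasurable_circleMean hp hf.1))
  have hAm : Measurable fun x : ℝ × ℝ => A x.1 x.2 :=
    measurable_indicator_one_sub_le measurable_id (by fun_prop)
  have hBm : Measurable fun x : Ico (0 : ℝ) 1 × ℝ => B x.1 x.2 :=
    measurable_indicator_one_sub_le measurable_subtype_coe (by fun_prop)
  set K := ENNReal.ofReal (4 * 4 ^ |E - 1|) with hK
  have step : ∀ t : Ico (0 : ℝ) 1, ∀ r ∈ Ioo (0 : ℝ) 1, ENNReal.ofReal ((1 - r) ^ (η - 1)) *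
      ENNReal.ofReal ((1 - (t : ℝ) * r) ^ E * circleMean p f (((t : ℝ) * r : ℝ) : ℂ)) ≤
      K * ∫⁻ u in Ico (1 / 2 : ℝ) 1, A r u * (B t u * D u) := by
    intro t r hr
    have ht0 := t.2.1
    have ht1 := t.2.2
    refine (mul_le_mul_right (one_sub_rpow_mul_circleMean_le hp hf.1 E
      (mul_nonneg ht0 hr.1.le) (by nlinarith [hr.1, hr.2])) _).trans ?_
    rw [mul_left_comm]
    refine mul_le_mul_right ?_ _
    rw [← lintegral_const_mul' _ _ ENNReal.ofReal_ne_top]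
    refine setLIntegral_mono' measurableSet_Ico fun u hu => ?_
    -- Since `1 - tr` dominates both `1 - t` and `1 - r`, the constraint on `tr` may be relaxed to
    -- separate constraints on `t` and `r`, encoded by `B` and `A`.
    by_cases h : 1 - (t : ℝ) * r ≤ 4 * (1 - u)
    · have h1 : r ∈ {r : ℝ | 1 - r ≤ 4 * (1 - u)} := by
        simp only [mem_ofPred_eq]; nlinarith [hr.1, hr.2]
      have h2 : t ∈ {t : Ico (0 : ℝ) 1 | 1 - (t : ℝ) ≤ 4 * (1 - u)} := by
        simp only [mem_ofPred_eq]; nlinarith [hr.1, hr.2]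
      simp only [hA, hB]
      rw [indicator_of_mem (show u ∈ {u : ℝ | 1 - (t : ℝ) * r ≤ 4 * (1 - u)} from h),
        indicator_of_mem h1, indicator_of_mem h2, one_mul]
    · rw [indicator_of_notMem (show u ∉ {u : ℝ | 1 - (t : ℝ) * r ≤ 4 * (1 - u)} from h), mul_zero]
      exact zero_le
  have swap1 : ∀ t, ∫⁻ r in Ioo (0 : ℝ) 1, ∫⁻ u in Ico (1 / 2 : ℝ) 1, A r u * (B t u * D u) =
      ∫⁻ u in Ico (1 / 2 : ℝ) 1, B t u * (D u * ∫⁻ r in Ioo (0 : ℝ) 1, A r u) := by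
    intro t
    rw [lintegral_lintegral_swap]
    · refine lintegral_congr fun u => ?_
      rw [lintegral_mul_const _ (f := fun r => A r u)
        (hAm.comp (by fun_prop : Measurable fun r : ℝ => (r, u)))]
      ring
    · refine AEMeasurable.mul hAm.aemeasurable (AEMeasurable.mul ?_ hDm.comp_snd)
      exact (hBm.comp (by fun_prop : Measurable fun x : ℝ × ℝ => (t, x.2))).aemeasurable
  have swap2 : ∫⁻ t, (∫⁻ u in Ico (1 / 2 : ℝ) 1,
        B t u * (D u * ∫⁻ r in Ioo (0 : ℝ) 1, A r u)) ∂μ =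
      ∫⁻ u in Ico (1 / 2 : ℝ) 1, (∫⁻ t, B t u ∂μ) * (D u * ∫⁻ r in Ioo (0 : ℝ) 1, A r u) := by
    rw [lintegral_lintegral_swap]
    · refine lintegral_congr fun u => ?_
      rw [lintegral_mul_const _ (f := fun t => B t u) (hBm.comp
        (by fun_prop : Measurable fun t : Ico (0 : ℝ) 1 => (t, u)))]
    · refine AEMeasurable.mul hBm.aemeasurable (AEMeasurable.mul hDm.comp_snd ?_)
      exact ((Measurable.lintegral_prod_left' hAm).comp measurable_snd).aemeasurable
  calc _ ≤ ∫⁻ t, (K * ∫⁻ r in Ioo (0 : ℝ) 1,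
        ∫⁻ u in Ico (1 / 2 : ℝ) 1, A r u * (B t u * D u)) ∂μ := by
        refine lintegral_mono fun t => ?_
        rw [← lintegral_const_mul' _ _ ENNReal.ofReal_ne_top]
        exact setLIntegral_mono' measurableSet_Ioo (step t)
    _ = K * ∫⁻ u in Ico (1 / 2 : ℝ) 1,
        (∫⁻ t, B t u ∂μ) * (D u * ∫⁻ r in Ioo (0 : ℝ) 1, A r u) := by
        rw [lintegral_const_mul' _ _ ENNReal.ofReal_ne_top]
        simp_rw [swap1]
        rw [swap2]
    _ ≤ K * ∫⁻ u in Ico (1 / 2 : ℝ) 1, ENNReal.ofReal (C * 4 ^ s * (4 ^ η / η)) *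
          ENNReal.ofReal ((1 - u) ^ α * circleMean p f u) := by
        refine mul_le_mul_right (setLIntegral_mono' measurableSet_Ico fun u hu => ?_) _
        have hu0 : 0 < 1 - u := by linarith [hu.2]
        have b1 : ∫⁻ t, B t u ∂μ ≤ ENNReal.ofReal (C * (4 * (1 - u)) ^ s) := by
          simp only [hB]
          rw [lintegral_indicator_const (measurableSet_le (by fun_prop) (by fun_prop)), one_mul]
          exact hμ _ (by linarith)
        have b2 : ∫⁻ r in Ioo (0 : ℝ) 1, A r u ≤ ENNReal.ofReal ((4 * (1 - u)) ^ η / η) :=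
          lintegral_one_sub_rpow_indicator_le hη (by linarith)
        refine (mul_le_mul' b1 (mul_le_mul_right b2 _)).trans (le_of_eq ?_)
        have hM := circleMean_nonneg p f u
        simp only [hD]
        rw [← ENNReal.ofReal_mul (by positivity), ← ENNReal.ofReal_mul' (by positivity),
          ← ENNReal.ofReal_mul' (by positivity)]
        congr 1
        -- The powers of `1 - u` are `E - 1` from the averaging, `s` from `μ` and `η` from the
        -- `r`-integral; together they give `α`.
        rw [← hE, Real.rpow_add hu0, Real.rpow_add hu0, Real.mul_rpow (by norm_num) hu0.le,
          Real.mul_rpow (by norm_num) hu0.le]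
        ring
    _ < ⊤ := by
        rw [lintegral_const_mul' _ _ ENNReal.ofReal_ne_top]
        exact ENNReal.mul_lt_top ENNReal.ofReal_lt_top (ENNReal.mul_lt_top ENNReal.ofReal_lt_top
          (lintegral_one_sub_rpow_circleMean_lt_top hp hf))

/-! ### Sufficiency of the Carleson condition -/

/-- The case `r = 0` bounds the total mass by `C`. This also covers `y > 1`, because `y ^ s ≥ 1`
when `s > 0`. -/
theorem IsCarleson.exists_bound {μ : Measure (Ico (0 : ℝ) 1)} {s : ℝ} (hs : 0 < s)
    (h : IsCarleson μ s) : IsFiniteMeasure μ ∧ ∃ C : ℝ, 0 < C ∧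
      ∀ y, 0 < y → μ {t | 1 - (t : ℝ) ≤ y} ≤ ENNReal.ofReal (C * y ^ s) := by
  obtain ⟨C, hC, hμ⟩ := h
  have htot : μ univ ≤ ENNReal.ofReal C := by
    have := hμ 0 le_rfl zero_lt_one
    rw [sub_zero, Real.one_rpow, mul_one] at this
    exact (measure_mono fun t _ => t.2.1).trans this
  refine ⟨⟨htot.trans_lt ENNReal.ofReal_lt_top⟩, C, hC, fun y hy => ?_⟩
  rcases le_or_gt y 1 with h1 | h1
  · have := hμ (1 - y) (by linarith) (by linarith)
    rw [sub_sub_cancel] at this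
    refine (measure_mono fun t ht => ?_).trans this
    simp only [mem_ofPred_eq] at ht ⊢
    linarith
  · refine ((measure_mono (subset_univ _)).trans htot).trans (ENNReal.ofReal_le_ofReal ?_)
    exact le_mul_of_one_le_right hC.le (Real.one_le_rpow h1.le hs.le)

/-- The function whose dilations are averaged by the Cesàro-type operator. -/
theorem differentiableOn_div_one_sub_cpow {f : ℂ → ℂ}
    (hf : DifferentiableOn ℂ f (Metric.ball 0 1)) (β : ℝ) :
    DifferentiableOn ℂ (fun w => f w / (1 - w) ^ (β : ℂ)) (Metric.ball 0 1) := by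
  have hs : ∀ w ∈ Metric.ball (0 : ℂ) 1, 1 - w ∈ Complex.slitPlane := by
    intro w hw
    rw [mem_ball_zero_iff] at hw
    refine Or.inl ?_
    have := (Complex.abs_re_le_norm w).trans_lt hw
    simp only [Complex.sub_re, Complex.one_re]
    linarith [(abs_lt.mp this).2]
  refine hf.div (DifferentiableOn.cpow (by fun_prop) (by fun_prop) hs) fun w hw => ?_
  have := Complex.slitPlane_ne_zero (hs w hw)
  simp [Complex.cpow_eq_zero_iff, this]

theorem measurable_ofReal_coe : Measurable fun t : Ico (0 : ℝ) 1 => ((t : ℝ) : ℂ) := by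
  fun_prop

theorem norm_ofReal_coe_le (t : Ico (0 : ℝ) 1) : ‖((t : ℝ) : ℂ)‖ ≤ 1 := by
  rw [Complex.norm_real, Real.norm_of_nonneg t.2.1]; exact t.2.2.le

theorem integrable_cesaroIntegrand {μ : Measure (Ico (0 : ℝ) 1)} [IsFiniteMeasure μ] {f : ℂ → ℂ}
    (hf : DifferentiableOn ℂ f (Metric.ball 0 1)) (β : ℝ) {z : ℂ}
    (hz : z ∈ Metric.ball (0 : ℂ) 1) : Integrable (cesaroIntegrand β f z) μ := by
  have := integrable_comp_mul (ν := μ) (differentiableOn_div_one_sub_cpow hf β).continuousOn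
    measurable_ofReal_coe norm_ofReal_coe_le (measurable_const (a := (1 : ℂ)))
    (M := 1) (fun _ => by simp) hz
  simp only [mul_one] at this
  exact this

theorem differentiableOn_cesaroOp {μ : Measure (Ico (0 : ℝ) 1)} [IsFiniteMeasure μ] {f : ℂ → ℂ}
    (hf : DifferentiableOn ℂ f (Metric.ball 0 1)) (β : ℝ) :
    DifferentiableOn ℂ (cesaroOp μ β f) (Metric.ball 0 1) := by
  have := differentiableOn_integral_comp_mul (ν := μ) (differentiableOn_div_one_sub_cpow hf β)
    measurable_ofReal_coe norm_ofReal_coe_le (measurable_const (a := (1 : ℂ)))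
    (M := 1) (fun _ => by simp)
  simp only [mul_one] at this
  exact this

theorem norm_cesaroIntegrand_le {β : ℝ} (hβ : 0 ≤ β) (f : ℂ → ℂ) {z : ℂ} (hz : ‖z‖ < 1)
    (t : Ico (0 : ℝ) 1) :
    ‖cesaroIntegrand β f z t‖ ≤ ‖f ((t : ℝ) * z)‖ * (1 - t * ‖z‖) ^ (-β) := by
  have hpos : 0 < 1 - (t : ℝ) * ‖z‖ := by nlinarith [t.2.1, t.2.2, norm_nonneg z]
  have h1 : 1 - (t : ℝ) * ‖z‖ ≤ ‖1 - ((t : ℝ) : ℂ) * z‖ := by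
    have := norm_sub_norm_le (1 : ℂ) (((t : ℝ) : ℂ) * z)
    rwa [norm_one, norm_mul, Complex.norm_real, Real.norm_of_nonneg t.2.1] at this
  rw [cesaroIntegrand, norm_div, Complex.norm_cpow_real, div_eq_mul_inv,
    ← Real.rpow_neg (norm_nonneg _)]
  exact mul_le_mul_of_nonneg_left (Real.rpow_le_rpow_of_nonpos hpos h1 (by linarith))
    (norm_nonneg _)

/-- Weighted Jensen in `t` with `h = (1 - t|z|)^a`. The factor `∫ h⁻¹` is controlled by the Carleson
bound, which needs `a > s`, and `|f|^(q-p)` is traded for a power of `1 - t|z|` through the growth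
bound `hfN`. -/
theorem cesaroOp_rpow_le {μ : Measure (Ico (0 : ℝ) 1)} [IsFiniteMeasure μ] {C s β p q γ N a : ℝ}
    (hC : 0 < C) (hs : 0 < s)
    (hμ : ∀ y, 0 < y → μ {t | 1 - (t : ℝ) ≤ y} ≤ ENNReal.ofReal (C * y ^ s))
    (hβ : 0 < β) (hp : 1 ≤ p) (hpq : p ≤ q) (ha : s < a) {f : ℂ → ℂ}
    (hf : DifferentiableOn ℂ f (Metric.ball 0 1)) (hN : 0 ≤ N)
    (hfN : ∀ z ∈ Metric.ball (0 : ℂ) 1, ‖f z‖ ≤ N * (1 - ‖z‖) ^ (-γ)) {z : ℂ} (hz : ‖z‖ < 1) :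
    ENNReal.ofReal (‖cesaroOp μ β f z‖ ^ q) ≤
      ENNReal.ofReal (N ^ (q - p) * (C * (a / (a - s))) ^ (q - 1)) *
        (ENNReal.ofReal ((1 - ‖z‖) ^ ((s - a) * (q - 1))) *
        ∫⁻ t, ENNReal.ofReal (‖f ((t : ℝ) * z)‖ ^ p *
          (1 - t * ‖z‖) ^ (-β * q + a * (q - 1) - γ * (q - p))) ∂μ) := by
  have hq : 1 ≤ q := hp.trans hpq
  have hzb : z ∈ Metric.ball (0 : ℂ) 1 := mem_ball_zero_iff.mpr hz
  have hpos : ∀ t : Ico (0 : ℝ) 1, 0 < 1 - (t : ℝ) * ‖z‖ := fun t => by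
    nlinarith [t.2.1, t.2.2, norm_nonneg z]
  have hfm : Measurable fun t : Ico (0 : ℝ) 1 => f ((t : ℝ) * z) :=
    measurable_comp_mul hf.continuousOn measurable_ofReal_coe norm_ofReal_coe_le hzb
  set g : Ico (0 : ℝ) 1 → ENNReal := fun t =>
    ENNReal.ofReal (‖f ((t : ℝ) * z)‖ * (1 - t * ‖z‖) ^ (-β)) with hg
  set h : Ico (0 : ℝ) 1 → ENNReal := fun t => ENNReal.ofReal ((1 - t * ‖z‖) ^ a) with hh
  have hgm : Measurable g :=
    ENNReal.measurable_ofReal.comp (hfm.norm.mul (by fun_prop))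
  have hhm : Measurable h := by fun_prop
  have h1 : ENNReal.ofReal ‖cesaroOp μ β f z‖ ≤ ∫⁻ t, g t ∂μ := by
    rw [ofReal_norm, cesaroOp]
    refine (enorm_integral_le_lintegral_enorm _).trans (lintegral_mono fun t => ?_)
    rw [← ofReal_norm]
    exact ENNReal.ofReal_le_ofReal (norm_cesaroIntegrand_le hβ.le f hz t)
  have h2 := lintegral_rpow_le_weighted μ hq hgm hhm
    (fun t => by simp [hh, Real.rpow_pos_of_pos (hpos t)]) (fun t => ENNReal.ofReal_ne_top)
  have h3 : ∫⁻ t, (h t)⁻¹ ∂μ ≤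
      ENNReal.ofReal (C * (a / (a - s))) * ENNReal.ofReal ((1 - ‖z‖) ^ (s - a)) := by
    refine le_trans (le_of_eq ?_) (lintegral_one_sub_mul_rpow_le μ measurable_subtype_coe
      (Filter.Eventually.of_forall fun t => t.2.1) (Filter.Eventually.of_forall fun t => t.2.2)
      hs ha hμ (norm_nonneg z) hz)
    refine lintegral_congr fun t => ?_
    simp only [hh]
    rw [← ENNReal.ofReal_inv_of_pos (Real.rpow_pos_of_pos (hpos t) _), Real.rpow_neg (hpos t).le]
  have h4 : ∀ t, g t ^ q * h t ^ (q - 1) ≤ ENNReal.ofReal (N ^ (q - p)) *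
      ENNReal.ofReal (‖f ((t : ℝ) * z)‖ ^ p *
        (1 - t * ‖z‖) ^ (-β * q + a * (q - 1) - γ * (q - p))) := by
    intro t
    have hx := hpos t
    have hfb := hfN _ (mul_mem_ball (norm_ofReal_coe_le t) hzb)
    rw [norm_mul, Complex.norm_real, Real.norm_of_nonneg t.2.1] at hfb
    simp only [hg, hh]
    rw [ENNReal.ofReal_rpow_of_nonneg (by positivity) (by linarith),
      ENNReal.ofReal_rpow_of_nonneg (by positivity) (by linarith),
      ← ENNReal.ofReal_mul (by positivity), ← ENNReal.ofReal_mul (by positivity)]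
    refine ENNReal.ofReal_le_ofReal ?_
    set x := 1 - (t : ℝ) * ‖z‖
    set A := ‖f ((t : ℝ) * z)‖
    have hA : 0 ≤ A := norm_nonneg _
    have e1 : A ^ q ≤ A ^ p * (N ^ (q - p) * x ^ (-γ * (q - p))) := by
      have : q = p + (q - p) := by ring
      conv_lhs => rw [this, Real.rpow_add_of_nonneg hA (by linarith) (by linarith)]
      refine mul_le_mul_of_nonneg_left ?_ (by positivity)
      rw [Real.rpow_mul hx.le, ← Real.mul_rpow hN (by positivity)]
      exact Real.rpow_le_rpow hA hfb (by linarith)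
    have e2 : x ^ (-β * q + a * (q - 1) - γ * (q - p)) =
        x ^ (-γ * (q - p)) * (x ^ (-β * q) * x ^ (a * (q - 1))) := by
      rw [← Real.rpow_add hx, ← Real.rpow_add hx]; congr 1; ring
    rw [Real.mul_rpow hA (by positivity), ← Real.rpow_mul hx.le, ← Real.rpow_mul hx.le, e2]
    calc A ^ q * x ^ (-β * q) * x ^ (a * (q - 1))
        = A ^ q * (x ^ (-β * q) * x ^ (a * (q - 1))) := by ring
      _ ≤ _ := mul_le_mul_of_nonneg_right e1 (by positivity)
      _ = _ := by ring
  have hK : 0 ≤ C * (a / (a - s)) := by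
    have : 0 < a - s := by linarith
    have : 0 < a := by linarith
    positivity
  have hz1 : 0 < 1 - ‖z‖ := by linarith
  calc ENNReal.ofReal (‖cesaroOp μ β f z‖ ^ q) = ENNReal.ofReal ‖cesaroOp μ β f z‖ ^ q := by
        rw [ENNReal.ofReal_rpow_of_nonneg (norm_nonneg _) (by linarith)]
    _ ≤ (∫⁻ t, g t ∂μ) ^ q := ENNReal.rpow_le_rpow h1 (by linarith)
    _ ≤ _ := h2
    _ ≤ (ENNReal.ofReal (N ^ (q - p)) * ∫⁻ t, ENNReal.ofReal (‖f ((t : ℝ) * z)‖ ^ p *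
        (1 - t * ‖z‖) ^ (-β * q + a * (q - 1) - γ * (q - p))) ∂μ) *
        (ENNReal.ofReal (C * (a / (a - s))) * ENNReal.ofReal ((1 - ‖z‖) ^ (s - a))) ^ (q - 1) := by
        refine mul_le_mul' ?_ (ENNReal.rpow_le_rpow h3 (by linarith))
        rw [← lintegral_const_mul' _ _ ENNReal.ofReal_ne_top]
        exact lintegral_mono h4
    _ = _ := by
        rw [ENNReal.mul_rpow_of_nonneg _ _ (by linarith),
          ENNReal.ofReal_rpow_of_nonneg hK (by linarith),
          ENNReal.ofReal_rpow_of_nonneg (by positivity) (by linarith),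
          ← Real.rpow_mul hz1.le, ENNReal.ofReal_mul (p := N ^ (q - p)) (by positivity)]
        ring

theorem circleMean_comp_mul (p : ℝ) (f : ℂ → ℂ) (t r : ℝ) :
    circleMean p (fun z => f (t * z)) r = circleMean p f ((t * r : ℝ) : ℂ) := by
  simp only [circleMean]
  congr 1; ext θ; congr 3
  push_cast; ring

/-- An `s`-Carleson measure induces an operator from `A^p_{α₁}` into `A^q_{α₂}`. -/
theorem IsCarleson.cesaroMapsInto {μ : Measure (Ico (0 : ℝ) 1)} {p q β α₁ α₂ : ℝ}
    (hp : 1 ≤ p) (hpq : p ≤ q) (hβ : 0 < β) (hα₂ : -1 < α₂)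
    (hs : 0 < β + (α₁ + 2) / p - (α₂ + 2) / q)
    (h : IsCarleson μ (β + (α₁ + 2) / p - (α₂ + 2) / q)) :
    CesaroMapsInto μ β (bergmanSpace p α₁) (bergmanSpace q α₂) := by
  intro f hf
  have hp0 : 0 < p := by linarith
  have hq0 : 0 < q := by linarith
  set s := β + (α₁ + 2) / p - (α₂ + 2) / q with hsdef
  obtain ⟨hfin, C, hC, hμ⟩ := h.exists_bound hs
  refine ⟨fun z hz => integrable_cesaroIntegrand hf.1 β hz, differentiableOn_cesaroOp hf.1 β, ?_⟩
  rw [lintegral_diskArea_lt_top_iff]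
  obtain ⟨N, hN, hfN⟩ := exists_growth_bound hp hf
  set γ := (α₁ + 2) / p with hγ
  -- With `a - s = η = (α₂+1)/q`, the powers of `1 - |z|` from Hölder and from the weight combine to
  -- exactly `η - 1`, integrable at the boundary since `α₂ > -1`.
  set η := (α₂ + 1) / q with hηdef
  have hη : 0 < η := div_pos (by linarith) hq0
  set a := s + η with hadef
  set E := -β * q + a * (q - 1) - γ * (q - p) with hEdef
  have hηq : η * q = α₂ + 1 := div_mul_cancel₀ _ hq0.ne'
  have hγp : γ * p = α₁ + 2 := div_mul_cancel₀ _ hp0.ne'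
  have hsq : s * q = β * q + γ * q - (α₂ + 2) := by
    rw [hsdef, sub_mul, add_mul, div_mul_cancel₀ _ hq0.ne']
  have hE : E - 1 + s + η = α₁ := by
    rw [hEdef, hadef]; linear_combination hsq + hηq + hγp
  have hη2 : (s - a) * (q - 1) + α₂ = η - 1 := by
    rw [hadef]; linear_combination -hηq
  set K := ENNReal.ofReal (N ^ (q - p) * (C * (a / (a - s))) ^ (q - 1)) with hK
  set B := Metric.ball (0 : ℂ) 1 with hB
  -- `f` is arbitrary outside the disc; extension by zero supplies the joint measurability that
  -- Tonelli requires.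
  set F := B.indicator f with hF
  have hFm : Measurable F := measurable_indicator_ball hf.1.continuousOn
  have hFf : ∀ (t : Ico (0 : ℝ) 1), ∀ z ∈ B, F ((t : ℝ) * z) = f ((t : ℝ) * z) := fun t z hz =>
    indicator_of_mem (mul_mem_ball (norm_ofReal_coe_le t) hz) f
  have step : ∀ z ∈ B, ENNReal.ofReal (‖cesaroOp μ β f z‖ ^ q * (1 - ‖z‖ ^ 2) ^ α₂) ≤
      (ENNReal.ofReal (4 ^ |α₂|) * K) * ∫⁻ t, ENNReal.ofReal ((1 - ‖z‖) ^ (η - 1)) *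
        ENNReal.ofReal (‖F ((t : ℝ) * z)‖ ^ p * (1 - t * ‖z‖) ^ E) ∂μ := by
    intro z hz
    have hz1 : ‖z‖ < 1 := mem_ball_zero_iff.mp hz
    have hz2 : 0 < 1 - ‖z‖ := by linarith
    have hz0 := norm_nonneg z
    have key := cesaroOp_rpow_le hC hs hμ hβ hp hpq (show s < a by linarith) hf.1 hN hfN hz1
    have k1 := rpow_le_of_comparable α₂ (d := 1 - ‖z‖ ^ 2) (x := 1 - ‖z‖) (by nlinarith)
      (by nlinarith) (by nlinarith)
    rw [lintegral_const_mul' _ _ ENNReal.ofReal_ne_top, ENNReal.ofReal_mul (by positivity)]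
    simp_rw [hFf _ z hz]
    refine (mul_le_mul' key (ENNReal.ofReal_le_ofReal k1)).trans (le_of_eq ?_)
    rw [← hη2, Real.rpow_add hz2, ENNReal.ofReal_mul (p := 4 ^ |α₂|) (by positivity),
      ENNReal.ofReal_mul (p := (1 - ‖z‖) ^ ((s - a) * (q - 1))) (by positivity)]
    ring
  refine lt_of_le_of_lt (setLIntegral_mono' measurableSet_ball step) ?_
  have hKt : ENNReal.ofReal (4 ^ |α₂|) * K ≠ ⊤ :=
    ENNReal.mul_ne_top ENNReal.ofReal_ne_top ENNReal.ofReal_ne_top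
  rw [lintegral_const_mul' _ _ hKt, lintegral_lintegral_swap]
  · refine ENNReal.mul_lt_top hKt.lt_top (lt_of_le_of_lt (lintegral_mono fun t => ?_)
      (lintegral_lintegral_circleMean_lt_top hμ hp hf hη hE))
    have hd : ContinuousOn (fun z : ℂ => f ((t : ℝ) * z)) B :=
      hf.1.continuousOn.comp (by fun_prop) fun z hz => mul_mem_ball (norm_ofReal_coe_le t) hz
    set w : ℝ → ENNReal := fun r =>
      ENNReal.ofReal ((1 - r) ^ (η - 1)) * ENNReal.ofReal ((1 - t * r) ^ E) with hw
    have e1 : ∫⁻ z in B, ENNReal.ofReal ((1 - ‖z‖) ^ (η - 1)) *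
        ENNReal.ofReal (‖F ((t : ℝ) * z)‖ ^ p * (1 - t * ‖z‖) ^ E) =
        ∫⁻ z in B, ENNReal.ofReal (‖f ((t : ℝ) * z)‖ ^ p) * w ‖z‖ := by
      refine setLIntegral_congr_fun measurableSet_ball fun z hz => ?_
      simp only [hw]
      rw [hFf t z hz, ENNReal.ofReal_mul (by positivity)]
      ring
    rw [e1, lintegral_ball_norm_rpow hp0.le hd (w := w) (by fun_prop)]
    refine setLIntegral_mono' measurableSet_Ioo fun r hr => ?_
    have hpos : 0 < 1 - (t : ℝ) * r := by nlinarith [t.2.1, t.2.2, hr.1, hr.2]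
    rw [circleMean_comp_mul, ENNReal.ofReal_mul (by positivity)]
    calc _ ≤ 1 * (ENNReal.ofReal (circleMean p f (((t : ℝ) * r : ℝ) : ℂ)) *
          (ENNReal.ofReal ((1 - r) ^ (η - 1)) * ENNReal.ofReal ((1 - t * r) ^ E))) := by
          refine mul_le_mul_left ?_ _
          rw [← ENNReal.ofReal_one]
          exact ENNReal.ofReal_le_ofReal hr.2.le
      _ = _ := by ring
  · refine Measurable.aemeasurable ?_
    refine Measurable.mul (by fun_prop) (ENNReal.measurable_ofReal.comp (Measurable.mul ?_ ?_))
    · exact (hFm.comp (by fun_prop)).norm.pow_const p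
    · fun_prop

/-! ### Poisson kernel and test functions -/

theorem norm_sub_ofReal_eq {x θ : ℝ} :
    ‖circleMap 0 1 θ - x‖ = ‖1 - x * Complex.exp (θ * Complex.I)‖ := by
  have h : ‖Complex.exp (θ * Complex.I) * (1 - x * (starRingEnd ℂ) (Complex.exp (θ * Complex.I)))‖ =
      ‖1 - x * Complex.exp (θ * Complex.I)‖ := by
    rw [norm_mul, Complex.norm_exp_ofReal_mul_I, one_mul, ← RCLike.norm_conj]
    simp
  rw [← h, mul_sub, mul_one, mul_left_comm, Complex.mul_conj, Complex.normSq_eq_norm_sq,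
    Complex.norm_exp_ofReal_mul_I]
  simp [circleMap]

/-- The total mass of the Poisson kernel. -/
theorem integral_inv_norm_one_sub_sq {x : ℝ} (h0 : 0 ≤ x) (h1 : x < 1) :
    ∫ θ in Ioc (-Real.pi) Real.pi, (‖1 - x * Complex.exp (θ * Complex.I)‖ ^ 2)⁻¹ =
      2 * Real.pi / (1 - x ^ 2) := by
  have hπ : -Real.pi ≤ Real.pi := by linarith [Real.pi_pos]
  have hx : (x : ℂ) ∈ Metric.ball (0 : ℂ) 1 := by
    rwa [mem_ball_zero_iff, Complex.norm_real, Real.norm_of_nonneg h0]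
  -- The Poisson integral of the constant `1`.
  have h := DiffContOnCl.circleAverage_poissonKernel_smul (R := 1) (c := 0) (f := fun _ => (1 : ℂ))
    (differentiable_const _).diffContOnCl hx
  set k : ℝ → ℝ := fun θ => (‖1 - x * Complex.exp (θ * Complex.I)‖ ^ 2)⁻¹ with hk
  have hper : Function.Periodic k (2 * Real.pi) := by
    intro θ
    simp only [hk]
    congr 5
    have := Complex.exp_periodic (θ * Complex.I)
    rw [← this]; push_cast; ring_nf
  have hint : ∫ θ in Ioc (-Real.pi) Real.pi, k θ = ∫ θ in (0 : ℝ)..(2 * Real.pi), k θ := by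
    rw [← intervalIntegral.integral_of_le hπ]
    have := hper.intervalIntegral_add_eq (-Real.pi) 0
    rw [zero_add] at this
    rw [← this]; congr 1; ring
  have e : ∀ θ : ℝ, (poissonKernel 0 (x : ℂ) • fun _ : ℂ => (1 : ℂ)) (circleMap 0 1 θ) =
      (((1 - x ^ 2) * k θ : ℝ) : ℂ) := by
    intro θ
    simp only [Pi.smul_apply', poissonKernel_def, sub_zero, norm_sub_ofReal_eq, hk]
    rw [norm_circleMap_zero, Complex.norm_real, Real.norm_of_nonneg h0]
    simp [div_eq_mul_inv]
  rw [Real.circleAverage_def] at h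
  simp_rw [e] at h
  rw [intervalIntegral.integral_ofReal, intervalIntegral.integral_const_mul, ← hint] at h
  have h' : (2 * Real.pi)⁻¹ * ((1 - x ^ 2) * ∫ θ in Ioc (-Real.pi) Real.pi, k θ) = 1 := by
    rw [Complex.real_smul] at h
    exact_mod_cast h
  have hx2 : 0 < 1 - x ^ 2 := by nlinarith
  have hpi := Real.pi_pos
  rw [eq_div_iff hx2.ne']
  field_simp at h'
  linarith

/-- The functions testing the boundedness of operators on Bergman spaces. -/
noncomputable def testFun (b : ℝ) (N : ℕ) (r : ℝ) (z : ℂ) : ℂ :=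
  (((1 - r) ^ b : ℝ) : ℂ) * ((1 - r * z) ^ N)⁻¹

theorem one_sub_mul_norm_le {r : ℝ} (h0 : 0 ≤ r) (z : ℂ) : 1 - r * ‖z‖ ≤ ‖1 - r * z‖ := by
  have := norm_sub_norm_le (1 : ℂ) (r * z)
  rwa [norm_one, norm_mul, Complex.norm_real, Real.norm_of_nonneg h0] at this

theorem norm_testFun {b r : ℝ} (N : ℕ) (h1 : r < 1) (z : ℂ) :
    ‖testFun b N r z‖ = (1 - r) ^ b * (‖1 - r * z‖ ^ N)⁻¹ := by
  have : 0 ≤ 1 - r := by linarith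
  rw [testFun, norm_mul, norm_inv, norm_pow, Complex.norm_real,
    Real.norm_of_nonneg (by positivity)]

theorem differentiableOn_testFun {b r : ℝ} (N : ℕ) (h0 : 0 ≤ r) (h1 : r < 1) :
    DifferentiableOn ℂ (testFun b N r) (Metric.ball 0 1) := by
  unfold testFun
  refine DifferentiableOn.const_mul (DifferentiableOn.inv (by fun_prop) fun z hz => ?_) _
  rw [mem_ball_zero_iff] at hz
  have := one_sub_mul_norm_le h0 z
  have h2 : 0 < ‖1 - r * z‖ := by nlinarith [norm_nonneg z]
  exact pow_ne_zero _ (norm_pos_iff.mp h2)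

/-- Two of the `N p` powers in the denominator form a Poisson kernel and are integrated exactly; the
other `N p - 2 ≥ 0` are bounded pointwise by `|1 - ρ r e^{iθ}| ≥ 1 - ρ r`. -/
theorem circleMean_testFun_le {p b r : ℝ} {N : ℕ} (hN : 2 ≤ N * p) (h0 : 0 ≤ r) (h1 : r < 1)
    {ρ : ℝ} (hρ0 : 0 ≤ ρ) (hρ1 : ρ < 1) :
    circleMean p (testFun b N r) ρ ≤
      2 * Real.pi * (1 - r) ^ (b * p) * (1 - ρ * r) ^ (-(N * p - 1)) := by
  have hx0 : 0 ≤ ρ * r := mul_nonneg hρ0 h0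
  have hx1 : ρ * r < 1 := by nlinarith
  have hr : 0 < 1 - r := by linarith
  set d := 1 - ρ * r with hd
  have hd0 : 0 < d := by linarith
  have hpt : ∀ θ : ℝ, ‖testFun b N r (Complex.exp (θ * Complex.I) * ρ)‖ ^ p ≤
      (1 - r) ^ (b * p) * d ^ (2 - N * p) *
        (‖1 - ((ρ * r : ℝ) : ℂ) * Complex.exp (θ * Complex.I)‖ ^ 2)⁻¹ := by
    intro θ
    have e1 : 1 - (r : ℂ) * (Complex.exp (θ * Complex.I) * ρ) =
        1 - ((ρ * r : ℝ) : ℂ) * Complex.exp (θ * Complex.I) := by push_cast; ring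
    have e2 : d ≤ ‖1 - ((ρ * r : ℝ) : ℂ) * Complex.exp (θ * Complex.I)‖ := by
      have := one_sub_mul_norm_le hx0 (Complex.exp (θ * Complex.I))
      rwa [Complex.norm_exp_ofReal_mul_I, mul_one] at this
    rw [norm_testFun N h1, e1]
    set A := ‖1 - ((ρ * r : ℝ) : ℂ) * Complex.exp (θ * Complex.I)‖
    have hA : 0 < A := hd0.trans_le e2
    have e3 : (A ^ N)⁻¹ ^ p = A ^ (2 - N * p) * (A ^ 2)⁻¹ := by
      rw [← Real.rpow_natCast, ← Real.rpow_natCast, ← Real.rpow_neg hA.le, ← Real.rpow_neg hA.le,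
        ← Real.rpow_mul hA.le, ← Real.rpow_add hA]
      congr 1; push_cast; ring
    rw [Real.mul_rpow (by positivity) (by positivity), ← Real.rpow_mul hr.le, e3, mul_assoc]
    refine mul_le_mul_of_nonneg_left (mul_le_mul_of_nonneg_right ?_ (by positivity)) (by positivity)
    exact Real.rpow_le_rpow_of_nonpos hd0 e2 (by linarith)
  have hρ : (ρ : ℂ) ∈ Metric.ball (0 : ℂ) 1 := by
    rwa [mem_ball_zero_iff, Complex.norm_real, Real.norm_of_nonneg hρ0]
  have hp : 0 ≤ p := by
    by_contra hp
    have : (N : ℝ) * p ≤ 0 := mul_nonpos_of_nonneg_of_nonpos (by positivity) (by linarith)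
    linarith
  have hcont : ContinuousOn (fun θ : ℝ => (1 - r) ^ (b * p) * d ^ (2 - N * p) *
        (‖1 - ((ρ * r : ℝ) : ℂ) * Complex.exp (θ * Complex.I)‖ ^ 2)⁻¹)
        (Icc (-Real.pi) Real.pi) := by
    refine ContinuousOn.mul continuousOn_const (ContinuousOn.inv₀ (by fun_prop) fun θ _ => ?_)
    have := one_sub_mul_norm_le hx0 (Complex.exp (θ * Complex.I))
    rw [Complex.norm_exp_ofReal_mul_I, mul_one] at this
    have : 0 < ‖1 - ((ρ * r : ℝ) : ℂ) * Complex.exp (θ * Complex.I)‖ := by linarith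
    positivity
  calc circleMean p (testFun b N r) ρ ≤ _ := integral_mono
        (integrable_norm_rpow_circle hp (differentiableOn_testFun N h0 h1).continuousOn hρ)
        (hcont.integrableOn_Icc.mono_set Ioc_subset_Icc_self) hpt
    _ = (1 - r) ^ (b * p) * d ^ (2 - N * p) * (2 * Real.pi / (1 - (ρ * r) ^ 2)) := by
        rw [integral_const_mul, integral_inv_norm_one_sub_sq hx0 hx1]
    _ ≤ (1 - r) ^ (b * p) * d ^ (2 - N * p) * (2 * Real.pi / d) := by
        refine mul_le_mul_of_nonneg_left ?_ (by positivity)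
        refine div_le_div_of_nonneg_left (by positivity) hd0 ?_
        rw [hd]; nlinarith
    _ = _ := by
        have : -(N * p - 1) = (2 - N * p) - 1 := by ring
        rw [this, Real.rpow_sub_one hd0.ne']
        ring

/-- The test functions are bounded in the Bergman space. -/
theorem exists_lintegral_testFun_le {p α : ℝ} (hp : 1 ≤ p) (hα : -1 < α) {N : ℕ}
    (hN : 2 ≤ N * p) (hNα : α + 2 < N * p) :
    ∃ K : ℝ, ∀ r, 0 ≤ r → r < 1 → ∫⁻ z in Metric.ball (0 : ℂ) 1,
      ENNReal.ofReal (‖testFun (N - (α + 2) / p) N r z‖ ^ p * (1 - ‖z‖ ^ 2) ^ α) ≤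
        ENNReal.ofReal K := by
  have hp0 : 0 < p := by linarith
  -- The radial weight is an `(α+1)`-Carleson measure, so the power estimate used for `μ` applies
  -- here with exponent `N p - 1 > α + 1`.
  set ν : Measure ℝ := (volume.restrict (Ioo (0 : ℝ) 1)).withDensity
    (fun ρ => ENNReal.ofReal ((1 - ρ) ^ α)) with hν
  have hwm : Measurable fun ρ : ℝ => ENNReal.ofReal ((1 - ρ) ^ α) := by fun_prop
  have hac : ν ≪ volume.restrict (Ioo (0 : ℝ) 1) := withDensity_absolutelyContinuous _ _
  have hmem : ∀ᵐ ρ ∂ν, ρ ∈ Ioo (0 : ℝ) 1 := hac.ae_le (self_mem_ae_restrict measurableSet_Ioo)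
  have hνc : ∀ y, 0 < y → ν {x | 1 - x ≤ y} ≤ ENNReal.ofReal (1 / (α + 1) * y ^ (α + 1)) := by
    intro y hy
    have hms : MeasurableSet {x : ℝ | 1 - x ≤ y} := measurableSet_le (by fun_prop) (by fun_prop)
    rw [hν, withDensity_apply _ hms, ← lintegral_indicator hms]
    have := lintegral_one_sub_rpow_indicator_le (η := α + 1) (by linarith) hy
    rw [add_sub_cancel_right] at this
    convert this using 2
    ring
  set b := (N : ℝ) - (α + 2) / p with hb
  have hbp : b * p = N * p - (α + 2) := by rw [hb, sub_mul, div_mul_cancel₀ _ hp0.ne']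
  set K₁ := 1 / (α + 1) * ((N * p - 1) / (N * p - 1 - (α + 1))) with hK₁
  refine ⟨2 * Real.pi * 4 ^ |α| * K₁, fun r h0 h1 => ?_⟩
  have hr : 0 < 1 - r := by linarith
  simp_rw [ENNReal.ofReal_mul (Real.rpow_nonneg (norm_nonneg _) p)]
  rw [lintegral_ball_norm_rpow hp0.le (differentiableOn_testFun N h0 h1).continuousOn
    (w := fun ρ => ENNReal.ofReal ((1 - ρ ^ 2) ^ α)) (by fun_prop)]
  calc _ ≤ ∫⁻ ρ in Ioo (0 : ℝ) 1, ENNReal.ofReal (2 * Real.pi * 4 ^ |α| * (1 - r) ^ (b * p)) *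
        (ENNReal.ofReal ((1 - ρ) ^ α) * ENNReal.ofReal ((1 - ρ * r) ^ (-(N * p - 1)))) := by
        refine setLIntegral_mono' measurableSet_Ioo fun ρ hρ => ?_
        have hρ0 := hρ.1
        have hρ1 := hρ.2
        have hM := circleMean_nonneg p (testFun b N r) ρ
        have k1 := rpow_le_of_comparable α (d := 1 - ρ ^ 2) (x := 1 - ρ) (by nlinarith)
          (by nlinarith) (by nlinarith)
        have k2 := circleMean_testFun_le (b := b) hN h0 h1 hρ0.le hρ1
        have k3 : (0 : ℝ) ≤ (1 - ρ ^ 2) ^ α := Real.rpow_nonneg (by nlinarith) _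
        have k4 : (0 : ℝ) ≤ (1 - ρ) ^ α := Real.rpow_nonneg (by linarith) _
        rw [← ENNReal.ofReal_mul hM, ← ENNReal.ofReal_mul hρ0.le, ← ENNReal.ofReal_mul k4,
          ← ENNReal.ofReal_mul (by positivity)]
        refine ENNReal.ofReal_le_ofReal ?_
        calc _ ≤ 1 * (circleMean p (testFun b N r) ρ * (1 - ρ ^ 2) ^ α) :=
              mul_le_mul_of_nonneg_right hρ1.le (mul_nonneg hM k3)
          _ ≤ 1 * (2 * Real.pi * (1 - r) ^ (b * p) * (1 - ρ * r) ^ (-(N * p - 1)) *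
              (4 ^ |α| * (1 - ρ) ^ α)) := by
              refine mul_le_mul_of_nonneg_left (mul_le_mul k2 k1 k3 (hM.trans k2)) zero_le_one
          _ = _ := by ring
    _ = ENNReal.ofReal (2 * Real.pi * 4 ^ |α| * (1 - r) ^ (b * p)) *
        ∫⁻ ρ, ENNReal.ofReal ((1 - ρ * r) ^ (-(N * p - 1))) ∂ν := by
        rw [lintegral_const_mul' _ _ ENNReal.ofReal_ne_top, hν,
          lintegral_withDensity_eq_lintegral_mul _ hwm (by fun_prop)]
        rfl
    _ ≤ ENNReal.ofReal (2 * Real.pi * 4 ^ |α| * (1 - r) ^ (b * p)) *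
        (ENNReal.ofReal K₁ * ENNReal.ofReal ((1 - r) ^ (α + 1 - (N * p - 1)))) := by
        refine mul_le_mul_right ?_ _
        exact lintegral_one_sub_mul_rpow_le ν measurable_id (hmem.mono fun x hx => hx.1.le)
          (hmem.mono fun x hx => hx.2) (by linarith) (by linarith) hνc h0 h1
    _ = _ := by
        rw [← ENNReal.ofReal_mul' (by positivity), ← ENNReal.ofReal_mul (by positivity)]
        congr 1
        -- The normalization `b = N - (α+2)/p` is chosen for this cancellation, which makes the
        -- bound uniform in `r`.
        have : (1 - r) ^ (b * p) * (1 - r) ^ (α + 1 - (N * p - 1)) = 1 := by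
          rw [← Real.rpow_add hr, hbp]
          have : N * p - (α + 2) + (α + 1 - (N * p - 1)) = 0 := by ring
          rw [this, Real.rpow_zero]
        linear_combination (2 * Real.pi * 4 ^ |α| * K₁) * this

/-- The bound does not depend on `r`, so it serves as the Weierstrass majorant for superpositions
along any sequence `r n`. -/
theorem norm_testFun_le_of_mem {b r ρ : ℝ} (N : ℕ) (hb : 0 ≤ b) (h0 : 0 ≤ r) (h1 : r < 1)
    (hρ : ρ < 1) {z : ℂ} (hz : ‖z‖ ≤ ρ) : ‖testFun b N r z‖ ≤ ((1 - ρ) ^ N)⁻¹ := by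
  rw [norm_testFun N h1]
  have h2 : 1 - ρ ≤ ‖1 - r * z‖ :=
    le_trans (by nlinarith [norm_nonneg z]) (one_sub_mul_norm_le h0 z)
  have h3 : 0 < 1 - ρ := by linarith
  calc _ ≤ 1 * ((1 - ρ) ^ N)⁻¹ := by
        refine mul_le_mul (Real.rpow_le_one (by linarith) (by linarith) hb) ?_ (by positivity)
          zero_le_one
        exact inv_anti₀ (by positivity) (pow_le_pow_left₀ h3.le h2 N)
    _ = _ := one_mul _

/-! ### Superposition of test functions -/

/-- The superposition of test functions concentrating near the points `r n`. -/
noncomputable def testSum (b : ℝ) (N : ℕ) (r : ℕ → ℝ) (z : ℂ) : ℂ :=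
  ∑' n, ((1 / 2 * (1 / 2) ^ n : ℝ) : ℂ) * testFun b N (r n) z

theorem tsum_half_pow : ∑' n : ℕ, (1 / 2 * (1 / 2) ^ n : ℝ) = 1 := by
  rw [tsum_mul_left, tsum_geometric_two]; norm_num

theorem summable_half_pow : Summable fun n : ℕ => (1 / 2 * (1 / 2) ^ n : ℝ) :=
  summable_geometric_two.mul_left _

theorem norm_half_mul_le {b ρ : ℝ} {N : ℕ} (hb : 0 ≤ b) {r : ℕ → ℝ} (h0 : ∀ n, 0 ≤ r n)
    (h1 : ∀ n, r n < 1) (hρ : ρ < 1) {z : ℂ} (hz : ‖z‖ ≤ ρ) (n : ℕ) :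
    ‖((1 / 2 * (1 / 2) ^ n : ℝ) : ℂ) * testFun b N (r n) z‖ ≤
      1 / 2 * (1 / 2) ^ n * ((1 - ρ) ^ N)⁻¹ := by
  rw [norm_mul, Complex.norm_real, Real.norm_of_nonneg (by positivity)]
  exact mul_le_mul_of_nonneg_left (norm_testFun_le_of_mem N hb (h0 n) (h1 n) hρ hz) (by positivity)

theorem differentiableOn_testSum {b : ℝ} (N : ℕ) (hb : 0 ≤ b) {r : ℕ → ℝ} (h0 : ∀ n, 0 ≤ r n)
    (h1 : ∀ n, r n < 1) : DifferentiableOn ℂ (testSum b N r) (Metric.ball 0 1) := by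
  intro z hz
  obtain ⟨ρ, hρ1, hρ2⟩ := exists_between (mem_ball_zero_iff.mp hz)
  have h := Complex.differentiableOn_tsum_of_summable_norm (U := Metric.ball (0 : ℂ) ρ)
    (F := fun n z => ((1 / 2 * (1 / 2) ^ n : ℝ) : ℂ) * testFun b N (r n) z)
    (summable_half_pow.mul_right ((1 - ρ) ^ N)⁻¹)
    (fun n => ((differentiableOn_testFun N (h0 n) (h1 n)).mono
      (Metric.ball_subset_ball hρ2.le)).const_mul _) Metric.isOpen_ball
    (fun n w hw => norm_half_mul_le hb h0 h1 hρ2 (mem_ball_zero_iff.mp hw).le n)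
  exact (h.differentiableAt (Metric.isOpen_ball.mem_nhds
    (mem_ball_zero_iff.mpr hρ1))).differentiableWithinAt

/-- Jensen for the probability measure on `ℕ` with masses `2^(-n-1)`. -/
theorem ofReal_norm_testSum_rpow_le {p b : ℝ} (hp : 1 ≤ p) (N : ℕ) (r : ℕ → ℝ) (z : ℂ) :
    ENNReal.ofReal (‖testSum b N r z‖ ^ p) ≤ ∑' n, ENNReal.ofReal (1 / 2 * (1 / 2) ^ n) *
      ENNReal.ofReal (‖testFun b N (r n) z‖ ^ p) := by
  set w : ℕ → ENNReal := fun n => ENNReal.ofReal (1 / 2 * (1 / 2) ^ n) with hw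
  have hwm : Measurable w := measurable_of_countable _
  have key := lintegral_rpow_le_lintegral_rpow_mul (Measure.count.withDensity w) hp
    (g := fun n => ENNReal.ofReal ‖testFun b N (r n) z‖) (measurable_of_countable _).aemeasurable
  rw [withDensity_apply _ MeasurableSet.univ, Measure.restrict_univ,
    lintegral_withDensity_eq_lintegral_mul _ hwm (measurable_of_countable _),
    lintegral_withDensity_eq_lintegral_mul _ hwm (measurable_of_countable _), lintegral_count,
    lintegral_count, lintegral_count] at key
  have hsum : ∑' n, w n = 1 := by
    rw [← ENNReal.ofReal_tsum_of_nonneg (fun n => by positivity) summable_half_pow, tsum_half_pow,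
      ENNReal.ofReal_one]
  rw [hsum, ENNReal.one_rpow, mul_one] at key
  simp only [Pi.mul_apply] at key
  rw [← ENNReal.ofReal_rpow_of_nonneg (norm_nonneg _) (by linarith)]
  refine le_trans (ENNReal.rpow_le_rpow ?_ (by linarith)) (key.trans (le_of_eq ?_))
  · rw [ofReal_norm, testSum]
    refine enorm_tsum_le_tsum_enorm.trans (le_of_eq ?_)
    refine tsum_congr fun n => ?_
    rw [← ofReal_norm, norm_mul, Complex.norm_real, Real.norm_of_nonneg (by positivity),
      ENNReal.ofReal_mul (by positivity)]
  · refine tsum_congr fun n => ?_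
    rw [ENNReal.ofReal_rpow_of_nonneg (norm_nonneg _) (by linarith)]

theorem measurable_testFun (b : ℝ) (N : ℕ) (r : ℝ) : Measurable (testFun b N r) := by
  unfold testFun
  exact Measurable.const_mul (Measurable.inv (by fun_prop)) _

/-- Convexity reduces the claim to the uniform bound on single test functions, so the sequence `r n`
may approach `1` at any rate. -/
theorem testSum_mem_bergmanSpace {p α : ℝ} (hp : 1 ≤ p) (hα : -1 < α) {N : ℕ}
    (hN : 2 ≤ N * p) (hNα : α + 2 < N * p) {r : ℕ → ℝ} (h0 : ∀ n, 0 ≤ r n) (h1 : ∀ n, r n < 1) :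
    testSum (N - (α + 2) / p) N r ∈ bergmanSpace p α := by
  have hp0 : 0 < p := by linarith
  set b := (N : ℝ) - (α + 2) / p with hb
  have hb0 : 0 ≤ b := by
    rw [hb, sub_nonneg, div_le_iff₀ hp0]; exact hNα.le
  refine ⟨differentiableOn_testSum N hb0 h0 h1, ?_⟩
  rw [lintegral_diskArea_lt_top_iff]
  obtain ⟨K, hK⟩ := exists_lintegral_testFun_le hp hα hN hNα
  calc _ ≤ ∫⁻ z in Metric.ball (0 : ℂ) 1, ∑' n, ENNReal.ofReal (1 / 2 * (1 / 2) ^ n) *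
        ENNReal.ofReal (‖testFun b N (r n) z‖ ^ p * (1 - ‖z‖ ^ 2) ^ α) := by
        refine setLIntegral_mono' measurableSet_ball fun z hz => ?_
        rw [ENNReal.ofReal_mul (by positivity)]
        simp_rw [fun n => ENNReal.ofReal_mul (q := (1 - ‖z‖ ^ 2) ^ α)
          (Real.rpow_nonneg (norm_nonneg (testFun b N (r n) z)) p), ← mul_assoc]
        rw [ENNReal.tsum_mul_right]
        exact mul_le_mul_left (ofReal_norm_testSum_rpow_le hp N r z) _
    _ = ∑' n, ENNReal.ofReal (1 / 2 * (1 / 2) ^ n) * ∫⁻ z in Metric.ball (0 : ℂ) 1,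
        ENNReal.ofReal (‖testFun b N (r n) z‖ ^ p * (1 - ‖z‖ ^ 2) ^ α) := by
        rw [lintegral_tsum]
        · simp_rw [lintegral_const_mul' _ _ ENNReal.ofReal_ne_top]
        · intro n
          refine (Measurable.const_mul (ENNReal.measurable_ofReal.comp
            (Measurable.mul ?_ (by fun_prop))) _).aemeasurable
          exact (measurable_testFun b N (r n)).norm.pow_const p
    _ ≤ ∑' n : ℕ, ENNReal.ofReal (1 / 2 * (1 / 2) ^ n) * ENNReal.ofReal K :=
        ENNReal.tsum_le_tsum fun n => mul_le_mul_right (hK _ (h0 n) (h1 n)) _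
    _ = ENNReal.ofReal K := by
        rw [ENNReal.tsum_mul_right, ← ENNReal.ofReal_tsum_of_nonneg (fun n => by positivity)
          summable_half_pow, tsum_half_pow, ENNReal.ofReal_one, one_mul]
    _ < ⊤ := ENNReal.ofReal_lt_top

/-- On the real radius the superposition is real and dominates each of its summands. -/
theorem exists_testSum_ofReal {b : ℝ} (N : ℕ) (hb : 0 ≤ b) {r : ℕ → ℝ} (h0 : ∀ n, 0 ≤ r n)
    (h1 : ∀ n, r n < 1) {y : ℝ} (hy0 : 0 ≤ y) (hy1 : y < 1) :
    ∃ x : ℝ, testSum b N r y = x ∧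
      ∀ n, 1 / 2 * (1 / 2) ^ n * ((1 - r n) ^ b * ((1 - r n * y) ^ N)⁻¹) ≤ x := by
  set u : ℕ → ℝ := fun n => 1 / 2 * (1 / 2) ^ n * ((1 - r n) ^ b * ((1 - r n * y) ^ N)⁻¹) with hu
  have hterm : ∀ n, ((1 / 2 * (1 / 2) ^ n : ℝ) : ℂ) * testFun b N (r n) y = (u n : ℂ) := by
    intro n
    simp only [testFun, hu]
    push_cast
    ring
  have hu0 : ∀ n, 0 ≤ u n := by
    intro n
    have k1 : 0 ≤ 1 - r n := by linarith [h1 n]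
    have k2 : 0 ≤ 1 - r n * y := by nlinarith [h1 n, h0 n]
    positivity
  have hsum : Summable u := by
    refine Summable.of_nonneg_of_le hu0 (fun n => ?_)
      (summable_half_pow.mul_right ((1 - y) ^ N)⁻¹)
    have := norm_half_mul_le (N := N) hb h0 h1 hy1 (z := (y : ℂ))
      (by rw [Complex.norm_real, Real.norm_of_nonneg hy0]) n
    rwa [hterm, Complex.norm_real, Real.norm_of_nonneg (hu0 n)] at this
  refine ⟨∑' n, u n, ?_, fun n => hsum.le_tsum n fun m _ => hu0 m⟩
  rw [testSum]
  simp_rw [hterm]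
  rw [Complex.ofReal_tsum]

/-! ### Necessity of the Carleson condition -/

/-- At the real point `x = r n` the integrand is nonnegative. On `t ≥ x` its `n`-th summand alone
gives the lower bound, through `1 - t x² ≤ 1 - x³ ≤ 3(1 - x)` and `1 - t x ≤ 1 - x² ≤ 2(1 - x)`;
Markov's inequality concludes. -/
theorem norm_cesaroOp_testSum_ge {μ : Measure (Ico (0 : ℝ) 1)} [IsFiniteMeasure μ] {b β : ℝ}
    (hβ : 0 ≤ β) (N : ℕ) (hb : 0 ≤ b) {r : ℕ → ℝ} (h0 : ∀ n, 0 ≤ r n) (h1 : ∀ n, r n < 1) (n : ℕ) :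
    1 / 2 * (1 / 2) ^ n * ((1 - r n) ^ b * ((3 * (1 - r n)) ^ N)⁻¹) * (2 * (1 - r n)) ^ (-β) *
      μ.real {t | r n ≤ (t : ℝ)} ≤ ‖cesaroOp μ β (testSum b N r) (r n)‖ := by
  set x := r n with hx
  have hx0 : 0 ≤ x := h0 n
  have hx1 : x < 1 := h1 n
  have hxb : (x : ℂ) ∈ Metric.ball (0 : ℂ) 1 := by
    rwa [mem_ball_zero_iff, Complex.norm_real, Real.norm_of_nonneg hx0]
  have hty0 : ∀ t : Ico (0 : ℝ) 1, 0 ≤ (t : ℝ) * x := fun t => mul_nonneg t.2.1 hx0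
  have hty1 : ∀ t : Ico (0 : ℝ) 1, (t : ℝ) * x < 1 := fun t => by nlinarith [t.2.1, t.2.2]
  choose φ hφ hφn using fun t : Ico (0 : ℝ) 1 =>
    exists_testSum_ofReal N hb h0 h1 (hty0 t) (hty1 t)
  have hφ0 : ∀ t, 0 ≤ φ t := fun t => by
    have k2 : 0 ≤ 1 - x * (t * x) := by nlinarith [hty0 t, hty1 t]
    have k3 : 0 ≤ 1 - x := by linarith
    exact le_trans (by positivity) (hφn t n)
  set k : Ico (0 : ℝ) 1 → ℝ := fun t => φ t * (1 - t * x) ^ (-β) with hk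
  have hpos : ∀ t : Ico (0 : ℝ) 1, 0 < 1 - (t : ℝ) * x := fun t => by linarith [hty1 t]
  have hk0 : ∀ t, 0 ≤ k t := fun t =>
    mul_nonneg (hφ0 t) (Real.rpow_nonneg (hpos t).le _)
  have hkc : cesaroIntegrand β (testSum b N r) x = fun t => (k t : ℂ) := by
    ext t
    have e := hφ t
    push_cast at e
    rw [cesaroIntegrand, e]
    simp only [hk]
    rw [Real.rpow_neg (hpos t).le, ← div_eq_mul_inv, Complex.ofReal_div,
      Complex.ofReal_cpow (hpos t).le]
    push_cast
    rfl
  have hint : Integrable k μ := by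
    have := integrable_cesaroIntegrand (μ := μ) (differentiableOn_testSum N hb h0 h1) β hxb
    rw [hkc] at this
    simpa using this.re
  have hnorm : ‖cesaroOp μ β (testSum b N r) x‖ = ∫ t, k t ∂μ := by
    rw [cesaroOp, hkc, integral_complex_ofReal, Complex.norm_real,
      Real.norm_of_nonneg (integral_nonneg hk0)]
  rw [hnorm]
  refine le_trans (mul_le_mul_of_nonneg_left (measureReal_mono fun t ht => ?_) ?_)
    (mul_meas_ge_le_integral_of_nonneg (Filter.Eventually.of_forall hk0) hint _)
  · have ht' : x ≤ (t : ℝ) := ht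
    have ht1 := t.2.2
    have k3 : 0 < 1 - x := by linarith
    have k4 : 0 < 1 - x * (t * x) := by nlinarith [hty0 t, hty1 t]
    have k5 : 1 - x * (t * x) ≤ 3 * (1 - x) := by
      have : x * (x * x) ≤ x * (t * x) := by gcongr
      nlinarith [mul_nonneg hx0 k3.le, mul_nonneg (mul_nonneg hx0 hx0) k3.le]
    have k6 : 1 - (t : ℝ) * x ≤ 2 * (1 - x) := by nlinarith
    have k7 : (2 * (1 - x)) ^ (-β) ≤ (1 - t * x) ^ (-β) :=
      Real.rpow_le_rpow_of_nonpos (hpos t) k6 (by linarith)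
    refine mul_le_mul (le_trans ?_ (hφn t n)) k7 (by positivity) (hφ0 t)
    gcongr
  · have k3 : 0 ≤ 1 - x := by linarith
    positivity

/-- For `f = 1` and `z = 0` the integrand is `1`, so absolute convergence means finite mass. The
constant `1` is the test function with `r = 0`, hence in the Bergman space. -/
theorem isFiniteMeasure_of_cesaroMapsInto {μ : Measure (Ico (0 : ℝ) 1)} {p α β : ℝ}
    {Y : Set (ℂ → ℂ)} (hp : 1 ≤ p) (hα : -1 < α)
    (h : CesaroMapsInto μ β (bergmanSpace p α) Y) : IsFiniteMeasure μ := by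
  have hmem : (fun _ => (1 : ℂ)) ∈ bergmanSpace p α := by
    obtain ⟨N, hN⟩ := exists_nat_ge (α + 4)
    have hNp : (N : ℝ) ≤ N * p := le_mul_of_one_le_right (by positivity) hp
    obtain ⟨K, hK⟩ := exists_lintegral_testFun_le hp hα (N := N) (by linarith) (by linarith)
    refine ⟨differentiableOn_const _, ?_⟩
    rw [lintegral_diskArea_lt_top_iff]
    refine lt_of_le_of_lt ?_ (ENNReal.ofReal_lt_top (r := K))
    simpa [testFun] using hK 0 le_rfl zero_lt_one
  have := (h _ hmem).1 0 (by simp)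
  have e : cesaroIntegrand β (fun _ => (1 : ℂ)) 0 = fun _ => 1 := by
    ext t; simp [cesaroIntegrand]
  rw [e, integrable_const_iff] at this
  exact this.resolve_left one_ne_zero

theorem isCarleson_of_cesaroMapsInto {μ : Measure (Ico (0 : ℝ) 1)} {p q β α₁ α₂ : ℝ}
    (hp : 1 ≤ p) (hq : 1 ≤ q) (hβ : 0 < β) (hα₁ : -1 < α₁)
    (h : CesaroMapsInto μ β (bergmanSpace p α₁) (bergmanSpace q α₂)) :
    IsCarleson μ (β + (α₁ + 2) / p - (α₂ + 2) / q) := by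
  have hfin := isFiniteMeasure_of_cesaroMapsInto hp hα₁ h
  have hp0 : 0 < p := by linarith
  set s := β + (α₁ + 2) / p - (α₂ + 2) / q with hs
  by_contra hnot
  -- The rate `4 ^ n` outweighs the coefficient `2^(-n-1)` in the superposition, leaving the
  -- unbounded factor `2 ^ n`.
  have hbad : ∀ n : ℕ, ∃ r : ℝ, 0 ≤ r ∧ r < 1 ∧
      ENNReal.ofReal (4 ^ n * (1 - r) ^ s) < μ {t | r ≤ (t : ℝ)} := by
    intro n
    by_contra hc
    refine hnot ⟨4 ^ n, by positivity, fun r h0 h1 => ?_⟩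
    by_contra hlt
    exact hc ⟨r, h0, h1, not_le.mp hlt⟩
  choose r h0 h1 hr using hbad
  -- `N ≥ α₁ + 4` gives both `N p ≥ 2` and `N p > α₁ + 2`, as `α₁ > -1` and `p ≥ 1`.
  obtain ⟨N, hN⟩ := exists_nat_ge (α₁ + 4)
  have hNp : (N : ℝ) ≤ N * p := le_mul_of_one_le_right (by positivity) hp
  set b := (N : ℝ) - (α₁ + 2) / p with hb
  have hb0 : 0 ≤ b := by
    rw [hb, sub_nonneg, div_le_iff₀ hp0]; linarith
  obtain ⟨G, hG0, hG⟩ := exists_growth_bound hq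
    (h _ (testSum_mem_bergmanSpace hp hα₁ (N := N) (by linarith) (by linarith) h0 h1)).2
  have hbound : ∀ n : ℕ, (2 : ℝ) ^ n ≤ 2 * 3 ^ N * 2 ^ β * G := by
    intro n
    have hd : 0 < 1 - r n := by linarith [h1 n]
    have hn : ‖((r n : ℝ) : ℂ)‖ = r n := by rw [Complex.norm_real, Real.norm_of_nonneg (h0 n)]
    have up := hG (r n) (by rw [mem_ball_zero_iff, hn]; exact h1 n)
    rw [hn] at up
    have low := norm_cesaroOp_testSum_ge (μ := μ) hβ.le N hb0 h0 h1 n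
    have hμ : 4 ^ n * (1 - r n) ^ s ≤ μ.real {t | r n ≤ (t : ℝ)} := by
      rw [measureReal_def, ← ENNReal.ofReal_le_iff_le_toReal (measure_ne_top _ _)]
      exact (hr n).le
    set d := 1 - r n
    -- The exponents satisfy `b - N - β + s = -(α₂+2)/q`, the growth rate in `A^q_α₂`; the powers of
    -- `d` therefore cancel against the upper bound.
    have e1 : 1 / 2 * (1 / 2) ^ n * (d ^ b * ((3 * d) ^ N)⁻¹) * (2 * d) ^ (-β) *
        (4 ^ n * d ^ s) = 2 ^ n * (2 * 3 ^ N * 2 ^ β)⁻¹ * d ^ (-((α₂ + 2) / q)) := by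
      have k1 : d ^ (-((α₂ + 2) / q)) = d ^ b * (d ^ N)⁻¹ * d ^ (-β) * d ^ s := by
        rw [← Real.rpow_natCast, ← Real.rpow_neg hd.le, ← Real.rpow_add hd, ← Real.rpow_add hd,
          ← Real.rpow_add hd]
        congr 1
        rw [hb, hs]; ring
      have k2 : (4 : ℝ) ^ n * (1 / 2) ^ n = 2 ^ n := by rw [← mul_pow]; norm_num
      rw [k1, mul_pow, Real.mul_rpow (by norm_num) hd.le, Real.rpow_neg (by norm_num) β, ← k2,
        mul_inv, mul_inv, mul_inv]
      ring
    have low' := (mul_le_mul_of_nonneg_left hμ (by positivity)).trans (low.trans up)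
    rw [e1] at low'
    have := le_of_mul_le_mul_right low' (Real.rpow_pos_of_pos hd _)
    rw [← div_eq_mul_inv, div_le_iff₀ (by positivity)] at this
    linarith
  obtain ⟨n, hn⟩ := pow_unbounded_of_one_lt (2 * 3 ^ N * 2 ^ β * G) (one_lt_two (α := ℝ))
  exact absurd (hbound n) (not_le.mpr hn)

end CesaroBergman

theorem mainTheorem2 (μ : MeasureTheory.Measure (Set.Ico (0 : ℝ) 1)) (p q β : ℝ)
    (hp : 1 ≤ p) (hpq : p ≤ q) (hβ : 0 < β) :
    (∀ α₁ α₂ : ℝ, -1 < α₁ → -1 < α₂ → 0 < β + (α₁ + 2) / p - (α₂ + 2) / q →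
      (CesaroBergman.CesaroMapsInto μ β
          (CesaroBergman.bergmanSpace p α₁) (CesaroBergman.bergmanSpace q α₂) ↔
        CesaroBergman.IsCarleson μ (β + (α₁ + 2) / p - (α₂ + 2) / q))) ∧
    (∀ α : ℝ, -1 < α →
      (CesaroBergman.CesaroMapsInto μ β
          (CesaroBergman.bergmanSpace p α) (CesaroBergman.bergmanSpace q α) ↔
        CesaroBergman.IsCarleson μ (β + (2 + α) * (1 / p - 1 / q)))) := by
  have ha : ∀ α₁ α₂ : ℝ, -1 < α₁ → -1 < α₂ → 0 < β + (α₁ + 2) / p - (α₂ + 2) / q →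
      (CesaroBergman.CesaroMapsInto μ β
          (CesaroBergman.bergmanSpace p α₁) (CesaroBergman.bergmanSpace q α₂) ↔
        CesaroBergman.IsCarleson μ (β + (α₁ + 2) / p - (α₂ + 2) / q)) :=
    fun α₁ α₂ h₁ h₂ hs =>
      ⟨CesaroBergman.isCarleson_of_cesaroMapsInto hp (hp.trans hpq) hβ h₁,
        CesaroBergman.IsCarleson.cesaroMapsInto hp hpq hβ h₂ hs⟩
  refine ⟨ha, fun α hα => ?_⟩
  have e : β + (2 + α) * (1 / p - 1 / q) = β + (α + 2) / p - (α + 2) / q := by ring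
  -- With equal weights, `p ≤ q` makes the exponent at least `β > 0`, so the positivity required in
  -- (a) is automatic.
  have hle : (α + 2) / q ≤ (α + 2) / p :=
    div_le_div_of_nonneg_left (by linarith) (by linarith) hpq
  rw [e]
  exact ha α α hα hα (by linarith)
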